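/- **Setting.** Let $M$ be a deterministic contextual MDP with horizon $H$, (discrete) state space $\mathcal S$ split into layers $\mathcal S_1,\dots,\mathcal S_H$, action space $\mathcal A$, initial distribution $\rho$ on $\mathcal S_1$, deterministic transitions from $\mathcal S_h\times\mathcal A$ to $\mathcal S_{h+1}$, and reward $r:\mathcal S\times\mathcal A\to\mathbb R$. A policy is a map $\pi:\mathcal S\to\Delta(\mathcal A)$; for a trajectory $\tau=(s_1,a_1),\dots,(s_H,a_H)$ write $\pi(\tau)=\prod_h\pi(a_h\mid s_h)$ and $r(\tau)=\sum_h r(s_h,a_h)$. "Trajectory" means one that can be generated in $M$, and $r(\tau)\in[0,R_{\max}]$ for all trajectories, $R_{\max}>0$. Fix a reference policy $\pi_{\mathrm{ref}}$ and $\beta>0$, and let $$J_\beta(\pi)=\mathbb E_\pi\Big[r(\tau)-\beta\log\tfrac{\pi(\tau)}{\pi_{\mathrm{ref}}(\tau)}\Big],\qquad \pi^\star_\beta\in\operatorname*{argmax}_{\pi}J_\beta(\pi)\ \text{ over all policies } \pi.$$ Let $\Pi$ be a finite class of policies with $\pi^\star_\beta\in\Pi$, such that for all $\pi\in\Pi$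 and all trajectories $\tau$, $\pi(\tau),\pi_{\mathrm{ref}}(\tau)>0$ and $|\log(\pi(\tau)/\pi_{\mathrm{ref}}(\tau))|\le V_{\max}/\beta$. Assume $V_{\max}+R_{\max}\ge1$. **Algorithm (XPO with a general sampling strategy).** A sampling strategy $\boldsymbol\pi_{\mathrm{samp}}$ maps every finite list of policies to a policy, or more generally to a mixture of policies (a random policy drawn at the start of the episode). Given $T\ge1$ and $\alpha$, put $\pi^{(1)}=\tilde\pi^{(1)}=\pi_{\mathrm{ref}}$. In iteration $t=1,\dots,T$: draw $s_1^{(t)}\sim\rho$, $\tau^{(t)}\sim\pi^{(t)}\mid s_1^{(t)}$, $\tilde\tau^{(t)}\sim\tilde\pi^{(t)}\mid s^{(t)}_1$; label the pair as $(\tau_+^{(t)},\tau_-^{(t)})$ by the Bradley–Terry model, i.e. $\tau_+^{(t)}=\tau^{(t)}$ with probability $e^{r(\tau^{(t)})}/(e^{r(\tau^{(t)})}+e^{r(\tilde\tau^{(t)})})$; draw a fresh set $\mathcal D^{(t)}_{\mathrm{opt}}$ of $t$ i.i.d. trajectories from $\tilde\pi^{(t)}$ (with initial states from $\rho$); let $$\pi^{(t+1)}\in\operatorname*{argmin}_{\pi\in\Pi}\Big\{\alpha\sum_{\tau\in\mathcal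 D^{(t)}_{\mathrm{opt}}}\log\pi(\tau)-\sum_{i\le t}\log\sigma\Big(\beta\log\tfrac{\pi(\tau^{(i)}_+)}{\pi_{\mathrm{ref}}(\tau^{(i)}_+)}-\beta\log\tfrac{\pi(\tau^{(i)}_-)}{\pi_{\mathrm{ref}}(\tau^{(i)}_-)}\Big)\Big\},\qquad \sigma(x)=\frac{e^x}{1+e^x},$$ with ties broken arbitrarily, and $\tilde\pi^{(t+1)}=\boldsymbol\pi_{\mathrm{samp}}(\pi^{(1)},\dots,\pi^{(t+1)})$. Return $\hat\pi\in\operatorname{argmax}_{\pi\in\{\pi^{(1)},\dots,\pi^{(T+1)}\}}J_\beta(\pi)$. *Plain XPO* is the same algorithm with $\tilde\pi^{(t)}=\pi_{\mathrm{ref}}$ for all $t$ and $\mathcal D_{\mathrm{opt}}^{(t)}=\{\tilde\tau^{(1)},\dots,\tilde\tau^{(t)}\}$. **Sequential Extrapolation Coefficient.** With $\delta_\pi(\tau,\tilde\tau)=\beta\log\frac{\pi(\tau)}{\pi_{\mathrm{ref}}(\tau)}-r(\tau)-\beta\log\frac{\pi(\tilde\tau)}{\pi_{\mathrm{ref}}(\tilde\tau)}+r(\tilde\tau)$,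 $$\mathrm{SEC}(\Pi,T,\beta;\boldsymbol\pi_{\mathrm{samp}})=\sup_{\pi^{(1)},\dots,\pi^{(T)}\in\Pi}\ \sum_{t=1}^T\frac{\big(\mathbb E_{s_1\sim\rho,\ \tau\sim\pi^{(t)}\mid s_1,\ \tilde\tau\sim\tilde\pi^{(t-1)}\mid s_1}[\delta_{\pi^{(t)}}(\tau,\tilde\tau)]\big)^2}{V_{\max}^2\vee\sum_{i<t}\mathbb E_{s_1\sim\rho,\ \tau\sim\pi^{(i)}\mid s_1,\ \tilde\tau\sim\tilde\pi^{(i)}\mid s_1}[\delta_{\pi^{(t)}}(\tau,\tilde\tau)^2]},$$ where $\tilde\pi^{(t)}=\boldsymbol\pi_{\mathrm{samp}}(\pi^{(1)},\dots,\pi^{(t)})$, and $\tilde\pi^{(0)}$ is the value of $\boldsymbol\pi_{\mathrm{samp}}$ at the empty list. Write $\mathrm{SEC}(\Pi,T,\beta;\pi_{\mathrm{ref}})$ for the strategy that is constantly $\pi_{\mathrm{ref}}$. **Theorem.** For every constant $c>0$ there is a constant $C>0$ depending only on $c$ such that, for every instance as above, every $T\ge1$ and every $\delta\in(0,1)$: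 1. If $\pi_{\mathrm{ref}}\in\Pi$ and $\mathrm{SEC}:=\mathrm{SEC}(\Pi,T,\beta;\boldsymbol\pi_{\mathrm{samp}})>0$, then XPO with sampling strategy $\boldsymbol\pi_{\mathrm{samp}}$ and $$\alpha=c\cdot\frac{\beta}{(V_{\max}+R_{\max})e^{2R_{\max}}}\sqrt{\frac{\log(|\Pi|T\delta^{-1})\log T}{T\cdot\mathrm{SEC}}}$$ satisfies, with probability at least $1-\delta$, $$J_\beta(\pi^\star_\beta)-J_\beta(\hat\pi)\le C\,(V_{\max}+R_{\max})e^{2R_{\max}}\sqrt{\frac{\max\{\mathrm{SEC}\cdot\log T,\,1\}\,\log(|\Pi|T\delta^{-1})}{T}};$$ in particular the right-hand side is $C(V_{\max}+R_{\max})e^{2R_{\max}}\sqrt{\mathrm{SEC}\,\log(|\Pi|T\delta^{-1})\log T/T}$ whenever $\mathrm{SEC}\cdot\log T\ge1$. 2. If $\mathrm{SEC}:=\mathrm{SEC}(\Pi,T,\beta;\pi_{\mathrm{ref}})>0$, then plain XPO with $\alpha$ given by the same formula satisfies the same bound with probability at least $1-\delta$ (here $\pi_{\mathrm{ref}}\in\Pi$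 is not needed). -/

import Mathlib

open scoped ENNReal NNReal

noncomputable section

namespace XPO

/-- A randomized policy `π : 𝒮 → Δ(𝒜)`. -/
abbrev Policy (S A : Type*) := S → PMF A

/-- A mixed policy: a policy is drawn once at the start of the episode and then followed.
An ordinary policy `π` is `PMF.pure π`; the uniform mixture `unif(π₁, …, πₜ)` is another example. -/
abbrev MixedPolicy (S A : Type*) := PMF (Policy S A)

/-- A sampling strategy maps `(π₁, …, πₜ)` to the sampling policy `π̃ₜ`. -/
abbrev Strategy (S A : Type*) := List (Policy S A) → MixedPolicy S A

/-- Trajectories `(s₁, a₁), …, (s_H, a_H)`. -/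
abbrev Traj (S A : Type*) := List (S × A)

/-- Expectation of a real-valued function under a discrete distribution. -/
def expect {X : Type*} (p : PMF X) (f : X → ℝ) : ℝ := ∑' x, (p x).toReal * f x

/-- `n` independent samples from `p`. -/
def iid {X : Type*} (p : PMF X) : ℕ → PMF (List X)
  | 0 => PMF.pure []
  | n + 1 => p.bind fun x => (iid p n).map fun l => x :: l

/-- `π(τ) = ∏ₕ π(aₕ ∣ sₕ)`. -/
def polProb {S A : Type*} (π : Policy S A) (τ : Traj S A) : ℝ :=
  (τ.map fun x => (π x.1 x.2).toReal).prod

/-- `log (π(τ) / π_ref(τ))`. -/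
def logRatio {S A : Type*} (π πref : Policy S A) (τ : Traj S A) : ℝ :=
  Real.log (polProb π τ / polProb πref τ)

/-- A deterministic contextual MDP of horizon `H`: random initial state, deterministic transitions,
and a state space split into layers `0, …, H - 1` (the layer is the time step, counted from `0`).
The value of `next` on the last layer is irrelevant. -/
structure DCMDP (S A : Type*) (H : ℕ) where
  init : PMF S
  next : S → A → S
  reward : S → A → ℝ
  layer : S → Fin H
  layer_init : ∀ s ∈ init.support, (layer s : ℕ) = 0
  layer_next : ∀ s a, (layer s : ℕ) + 1 < H → (layer (next s a) : ℕ) = (layer s : ℕ) + 1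

namespace DCMDP

variable {S A : Type*} {H : ℕ} (M : DCMDP S A H)

/-- The trajectory obtained from state `s` by playing a given list of actions. -/
def path : S → List A → Traj S A
  | _, [] => []
  | s, a :: as => (s, a) :: path (M.next s a) as

/-- Admissible trajectories: those that some policy can generate. -/
def Admissible (τ : Traj S A) : Prop :=
  ∃ s ∈ M.init.support, ∃ as : List A, as.length = H ∧ τ = M.path s as

/-- `r(τ) = ∑ₕ r(sₕ, aₕ)`. -/
def ret (τ : Traj S A) : ℝ := (τ.map fun x => M.reward x.1 x.2).sum

/-- Law of the next `n` state-action pairs from state `s` under `π`. -/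
def rollout (π : Policy S A) : ℕ → S → PMF (Traj S A)
  | 0, _ => PMF.pure []
  | n + 1, s => (π s).bind fun a => (rollout π n (M.next s a)).map fun τ => (s, a) :: τ

/-- Law of `τ ∼ π̃ ∣ s₁` for a mixed policy. -/
def response (ν : MixedPolicy S A) (s : S) : PMF (Traj S A) :=
  ν.bind fun π => M.rollout π H s

/-- Law of `τ` when `s₁ ∼ ρ`, `τ ∼ π̃ ∣ s₁`. -/
def trajLaw (ν : MixedPolicy S A) : PMF (Traj S A) :=
  M.init.bind fun s => M.response ν s

/-- Law of `(τ, τ̃)` when `s₁ ∼ ρ`, and then `τ ∼ π ∣ s₁` and `τ̃ ∼ π̃ ∣ s₁` independently. -/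
def pairLaw (π : Policy S A) (ν : MixedPolicy S A) : PMF (Traj S A × Traj S A) :=
  M.init.bind fun s => (M.rollout π H s).bind fun τ => (M.response ν s).map fun τ' => (τ, τ')

/-- The integrand `r(τ) - β log (π(τ) / π_ref(τ))` of the KL-regularized objective. -/
def klReward (πref : Policy S A) (β : ℝ) (π : Policy S A) (τ : Traj S A) : ℝ :=
  M.ret τ - β * logRatio π πref τ

/-- The KL-regularized objective `J_β(π) = 𝔼_π[r(τ) - β log (π(τ) / π_ref(τ))]`. -/
def J (πref : Policy S A) (β : ℝ) (π : Policy S A) : ℝ :=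
  expect (M.trajLaw (PMF.pure π)) (M.klReward πref β π)

/-- The expectation defining `J_β(π)` is finite (for bounded returns and `π_ref` of full support
it can otherwise only be `-∞`). -/
def FiniteJ (πref : Policy S A) (β : ℝ) (π : Policy S A) : Prop :=
  Summable fun τ => (M.trajLaw (PMF.pure π) τ).toReal * M.klReward πref β π τ

/-- `π ∈ argmax J_β` over all policies; policies with `J_β = -∞` impose no constraint. -/
def IsOptimal (πref : Policy S A) (β : ℝ) (π : Policy S A) : Prop :=
  M.FiniteJ πref β π ∧ ∀ π', M.FiniteJ πref β π' → M.J πref β π' ≤ M.J πref β π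

/-- The total reward of a trajectory always lies in `[0, R_max]`. -/
def BoundedReturn (R : ℝ) : Prop := ∀ τ, M.Admissible τ → M.ret τ ∈ Set.Icc 0 R

/-- Bounded density ratios: `|log (π(τ) / π_ref(τ))| ≤ V_max / β` for every `π ∈ Π` and every
trajectory; positivity says that the logarithm is finite. -/
def BoundedRatio (πref : Policy S A) (Pol : Finset (Policy S A)) (β V : ℝ) : Prop :=
  ∀ π ∈ Pol, ∀ τ, M.Admissible τ →
    0 < polProb πref τ ∧ 0 < polProb π τ ∧ |logRatio π πref τ| ≤ V / β

/-! ### The Sequential Extrapolation Coefficient -/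

/-- `β log (π(τ)/π_ref(τ)) - r(τ) - β log (π(τ̃)/π_ref(τ̃)) + r(τ̃)`. -/
def discrepancy (πref : Policy S A) (β : ℝ) (π : Policy S A) (x : Traj S A × Traj S A) : ℝ :=
  β * logRatio π πref x.1 - M.ret x.1 - β * logRatio π πref x.2 + M.ret x.2

/-- `π̃ₜ = π_samp(π₁, …, πₜ)` for a sequence of policies indexed from `1`. -/
def tilde (samp : Strategy S A) (p : ℕ → Policy S A) (t : ℕ) : MixedPolicy S A :=
  samp ((List.range t).map fun i => p (i + 1))

/-- Expectation under `μₜ = (t-1)⁻¹ ∑_{i<t} πᵢ ⊗ π̃ᵢ`. -/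
def muExpect (samp : Strategy S A) (p : ℕ → Policy S A) (t : ℕ)
    (f : Traj S A × Traj S A → ℝ) : ℝ :=
  ((t : ℝ) - 1)⁻¹ * ∑ i ∈ Finset.Ico 1 t, expect (M.pairLaw (p i) (tilde samp p i)) f

/-- The `t`-th summand in the definition of the SEC. -/
def secTerm (πref : Policy S A) (β V : ℝ) (samp : Strategy S A) (p : ℕ → Policy S A)
    (t : ℕ) : ℝ :=
  (expect (M.pairLaw (p t) (tilde samp p (t - 1))) (M.discrepancy πref β (p t))) ^ 2 /
    max (V ^ 2)
      (((t : ℝ) - 1) * M.muExpect samp p t fun x => (M.discrepancy πref β (p t) x) ^ 2)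

/-- `SEC(Π, T, β; π_samp)`. -/
def SEC (πref : Policy S A) (Pol : Finset (Policy S A)) (T : ℕ) (β V : ℝ)
    (samp : Strategy S A) : ℝ :=
  ⨆ p : {p : ℕ → Policy S A // ∀ t, p t ∈ Pol},
    ∑ t ∈ Finset.Icc 1 T, M.secTerm πref β V samp p.1 t

/-! ### The algorithm -/

/-- The Bradley–Terry preference: `true`, meaning `τ ≻ τ̃`, has probability
`exp(r(τ)) / (exp(r(τ)) + exp(r(τ̃)))`, and `false` has the complementary probability
`exp(r(τ̃)) / (exp(r(τ)) + exp(r(τ̃)))`. -/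
def preference (τ τ' : Traj S A) : PMF Bool :=
  PMF.ofFintype
    (fun y => ENNReal.ofReal
      (Real.exp (M.ret (if y then τ else τ')) / (Real.exp (M.ret τ) + Real.exp (M.ret τ'))))
    (by
      have h : 0 < Real.exp (M.ret τ) + Real.exp (M.ret τ') := by positivity
      rw [Fintype.sum_bool, ← ENNReal.ofReal_add (by positivity) (by positivity), ← add_div]
      simp [div_self h.ne'])

end DCMDP

section Algorithm

variable {S A : Type*} {H : ℕ}

/-- The optimistic DPO objective
`α ∑_{τ ∈ D_opt} log π(τ) - ∑_{(τ₊, τ₋) ∈ D_pref} log σ(β log (π(τ₊)/π_ref(τ₊)) - β log (π(τ₋)/π_ref(τ₋)))`. -/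
def objective (πref : Policy S A) (β α : ℝ) (prefs : List (Traj S A × Traj S A))
    (opt : List (Traj S A)) (π : Policy S A) : ℝ :=
  α * (opt.map fun τ => Real.log (polProb π τ)).sum -
    (prefs.map fun x =>
      Real.log (Real.sigmoid (β * logRatio π πref x.1 - β * logRatio π πref x.2))).sum

/-- State of the algorithm at the beginning of iteration `t`. -/
structure State (S A : Type*) where
  /-- `π₁, …, π_{t-1}` -/
  past : List (Policy S A)
  /-- `πₜ` -/
  cur : Policy S A
  /-- the sampling policy `π̃ₜ` -/
  sampler : MixedPolicy S A
  /-- the preference data, as pairs `(τ₊, τ₋)` -/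
  prefs : List (Traj S A × Traj S A)
  /-- the second responses `τ̃₁, …, τ̃_{t-1}` -/
  seconds : List (Traj S A)

/-- `π₁, …, πₜ`. -/
def State.policies (st : State S A) : List (Policy S A) := st.past ++ [st.cur]

/-- A way of computing the minimizer: given the state, the updated preference data and the optimism
data, it returns a policy. Ties may be broken using the whole state. -/
abbrev Selector (S A : Type*) :=
  State S A → List (Traj S A × Traj S A) → List (Traj S A) → Policy S A

/-- The selector always returns a minimizer over `Π` of the optimistic DPO objective. -/
def IsArgmin (πref : Policy S A) (Pol : Finset (Policy S A)) (β α : ℝ)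
    (sel : Selector S A) : Prop :=
  ∀ st prefs opt, sel st prefs opt ∈ Pol ∧
    ∀ π ∈ Pol, objective πref β α prefs opt (sel st prefs opt) ≤ objective πref β α prefs opt π

/-- One iteration. Here `draw π̃ₜ [τ̃₁, …, τ̃ₜ]` is the law of the optimism data. -/
def step (M : DCMDP S A H) (samp : Strategy S A) (sel : Selector S A)
    (draw : MixedPolicy S A → List (Traj S A) → PMF (List (Traj S A)))
    (st : State S A) : PMF (State S A) :=
  M.init.bind fun s =>
  (M.rollout st.cur H s).bind fun τ =>
  (M.response st.sampler s).bind fun τ' =>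
  (M.preference τ τ').bind fun y =>
    let prefs := st.prefs ++ [if y then (τ, τ') else (τ', τ)]
    let seconds := st.seconds ++ [τ']
    (draw st.sampler seconds).map fun opt =>
      let new := sel st prefs opt
      { past := st.policies
        cur := new
        sampler := samp (st.policies ++ [new])
        prefs := prefs
        seconds := seconds }

/-- The state after a given number of iterations, started from `π₁ = π̃₁ = π_ref`. -/
def run (M : DCMDP S A H) (πref : Policy S A) (samp : Strategy S A) (sel : Selector S A)
    (draw : MixedPolicy S A → List (Traj S A) → PMF (List (Traj S A))) : ℕ → PMF (State S A)
  | 0 => PMF.pure ⟨[], πref, PMF.pure πref, [], []⟩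
  | t + 1 => (run M πref samp sel draw t).bind (step M samp sel draw)

/-- The strategy that always samples from `π_ref`. -/
def refStrategy (πref : Policy S A) : Strategy S A := fun _ => PMF.pure πref

/-- XPO with a general sampling strategy: at iteration `t` the optimism data consists of `t` fresh
independent trajectories drawn from `π̃ₜ`. -/
def runGeneral (M : DCMDP S A H) (πref : Policy S A) (samp : Strategy S A) (sel : Selector S A)
    (T : ℕ) : PMF (State S A) :=
  run M πref samp sel (fun ν seconds => iid (M.trajLaw ν) seconds.length) T

/-- Plain XPO: the second response is always drawn from `π_ref`, and the optimism data is
`τ̃₁, …, τ̃ₜ`. -/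
def runXPO (M : DCMDP S A H) (πref : Policy S A) (sel : Selector S A) (T : ℕ) : PMF (State S A) :=
  run M πref (refStrategy πref) sel (fun _ seconds => PMF.pure seconds) T

/-- `π̂ ∈ argmax_{π ∈ {π₁, …, π_{T+1}}} J_β(π)`. -/
def IsOutput (M : DCMDP S A H) (πref : Policy S A) (β : ℝ) (st : State S A)
    (πhat : Policy S A) : Prop :=
  πhat ∈ st.policies ∧ ∀ π ∈ st.policies, M.J πref β π ≤ M.J πref β πhat

end Algorithm

/-- `log (|Π| T δ⁻¹)`. -/
def logTerm (card T : ℕ) (δ : ℝ) : ℝ := Real.log (card * T * δ⁻¹)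

/-- The optimism parameter
`α = c · β / ((V_max + R_max) e^{2 R_max}) · √(log(|Π| T δ⁻¹) log T / (T · SEC))`. -/
def alphaParam (c β V R : ℝ) (card T : ℕ) (δ sec : ℝ) : ℝ :=
  c * (β / ((V + R) * Real.exp (2 * R))) *
    √(logTerm card T δ * Real.log T / (T * sec))

/-- The rate `(V_max + R_max) e^{2 R_max} √(max(SEC · log T, 1) log(|Π| T δ⁻¹) / T)`, which is
`(V_max + R_max) e^{2 R_max} √(SEC · log(|Π| T δ⁻¹) log T / T)` as soon as `SEC · log T ≥ 1`. -/
def rate (V R : ℝ) (card T : ℕ) (δ sec : ℝ) : ℝ :=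
  (V + R) * Real.exp (2 * R) * √(max (sec * Real.log T) 1 * logTerm card T δ / T)

end XPO

end

/-!
By Gibbs' variational principle and the determinism of the transitions, the optimal policy satisfies
`β log (π⋆(τ)/π_ref(τ)) = r(τ) - const(s₁)` on every trajectory, so its discrepancy vanishes. Hence,
for every policy `π` and every sampling policy `π̃`,
`J_β(π⋆) - J_β(π) = 𝔼[δ_π] + β 𝔼_π̃[log π - log π⋆]`,
where the first expectation is over pairs drawn from `π` and `π̃` with a common initial state.

For the minimizer `π`, comparing its objective with that of `π⋆` bounds the second term, up to the
deviation of the optimism data, by `β / (α n)` times a log-likelihood ratio. The square roots of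
likelihood ratios form a supermartingale, and the Hellinger distance between Bradley–Terry
distributions dominates the squared discrepancy, so with high probability this log-likelihood ratio
is at most a logarithmic term minus a multiple of the in-sample squared discrepancy of `π`. The
negative term pays for the first expectation: by AM-GM, `𝔼[δ_π]` is at most the same multiple of
the in-sample error plus a summand of the SEC, and the sum of these summands over all iterations is
the SEC itself.
-/

noncomputable section

namespace XPO

/-! ### Expectations under discrete distributions -/

section Expectation

variable {X Y : Type*}

/-- Expectation of an extended nonnegative function under a discrete distribution. Unlike `expect`
it commutes with `PMF.bind` without any summability condition. -/
def eexpect (p : PMF X) (f : X → ℝ≥0∞) : ℝ≥0∞ := ∑' x, p x * f x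

lemma eexpect_mono {p : PMF X} {f g : X → ℝ≥0∞} (h : ∀ x ∈ p.support, f x ≤ g x) :
    eexpect p f ≤ eexpect p g := by
  refine ENNReal.tsum_le_tsum fun x => ?_
  by_cases hx : p x = 0
  · simp [hx]
  · gcongr
    exact h x ((p.mem_support_iff x).2 hx)

lemma eexpect_congr {p : PMF X} {f g : X → ℝ≥0∞} (h : ∀ x ∈ p.support, f x = g x) :
    eexpect p f = eexpect p g :=
  le_antisymm (eexpect_mono fun x hx => (h x hx).le) (eexpect_mono fun x hx => (h x hx).ge)

@[simp]
lemma eexpect_const (p : PMF X) (a : ℝ≥0∞) : eexpect p (fun _ => a) = a := by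
  rw [eexpect, ENNReal.tsum_mul_right, p.tsum_coe, one_mul]

lemma eexpect_le_const {p : PMF X} {f : X → ℝ≥0∞} {a : ℝ≥0∞} (h : ∀ x ∈ p.support, f x ≤ a) :
    eexpect p f ≤ a :=
  (eexpect_mono h).trans_eq (eexpect_const p a)

lemma eexpect_add (p : PMF X) (f g : X → ℝ≥0∞) :
    eexpect p (fun x => f x + g x) = eexpect p f + eexpect p g := by
  simp only [eexpect, mul_add, ENNReal.tsum_add]

lemma eexpect_const_mul (p : PMF X) (a : ℝ≥0∞) (f : X → ℝ≥0∞) :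
    eexpect p (fun x => a * f x) = a * eexpect p f := by
  simp only [eexpect, mul_left_comm _ a, ENNReal.tsum_mul_left]

@[simp]
lemma eexpect_pure (a : X) (f : X → ℝ≥0∞) : eexpect (PMF.pure a) f = f a := by
  rw [eexpect, tsum_eq_single a]
  · simp
  · intro x hx
    simp [PMF.pure_apply_of_ne _ _ hx]

lemma eexpect_bind (p : PMF X) (q : X → PMF Y) (f : Y → ℝ≥0∞) :
    eexpect (p.bind q) f = eexpect p fun x => eexpect (q x) f := by
  simp only [eexpect, PMF.bind_apply, ← ENNReal.tsum_mul_right, ← ENNReal.tsum_mul_left]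
  rw [ENNReal.tsum_comm]
  simp only [mul_assoc]

lemma eexpect_map (p : PMF X) (g : X → Y) (f : Y → ℝ≥0∞) :
    eexpect (p.map g) f = eexpect p fun x => f (g x) := by
  simp only [PMF.map, eexpect_bind, Function.comp_apply, eexpect_pure]

lemma toOuterMeasure_eq_eexpect (p : PMF X) (s : Set X) :
    p.toOuterMeasure s = eexpect p (s.indicator fun _ => 1) := by
  rw [PMF.toOuterMeasure_apply, eexpect]
  refine tsum_congr fun x => ?_
  by_cases hx : x ∈ s <;> simp [hx]

lemma one_sub_le_toOuterMeasure {p : PMF X} {s t : Set X} {δ : ℝ} (hδ : 0 ≤ δ)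
    (hst : ∀ x ∈ p.support, x ∉ t → x ∈ s) (ht : p.toOuterMeasure t ≤ ENNReal.ofReal δ) :
    ENNReal.ofReal (1 - δ) ≤ p.toOuterMeasure s := by
  rw [ENNReal.ofReal_sub 1 hδ, ENNReal.ofReal_one, tsub_le_iff_right]
  calc (1 : ℝ≥0∞) = eexpect p (fun _ => 1) := (eexpect_const p 1).symm
    _ ≤ eexpect p (fun x => s.indicator (fun _ => 1) x + t.indicator (fun _ => 1) x) := by
        refine eexpect_mono fun x hx => ?_
        by_cases hxt : x ∈ t
        · simp [hxt]
        · simp [hxt, hst x hx hxt]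
    _ = p.toOuterMeasure s + p.toOuterMeasure t := by
        rw [eexpect_add, toOuterMeasure_eq_eexpect, toOuterMeasure_eq_eexpect]
    _ ≤ _ := by gcongr

/-- The function `f` is bounded on the support of `p`. This is the form of integrability used
throughout: it makes the series defining `expect p f` converge. -/
def BddOn (p : PMF X) (f : X → ℝ) : Prop := ∃ B, ∀ x ∈ p.support, |f x| ≤ B

namespace BddOn

variable {p : PMF X} {f g : X → ℝ}

lemma summable (h : BddOn p f) : Summable fun x => (p x).toReal * f x := by
  obtain ⟨B, hB⟩ := h
  have hp : Summable fun x => (p x).toReal := ENNReal.summable_toReal p.tsum_coe_ne_top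
  refine Summable.of_norm_bounded (hp.mul_right B) fun x => ?_
  rw [norm_mul, Real.norm_of_nonneg ENNReal.toReal_nonneg, Real.norm_eq_abs]
  by_cases hx : p x = 0
  · simp [hx]
  · exact mul_le_mul_of_nonneg_left (hB x ((p.mem_support_iff x).2 hx)) ENNReal.toReal_nonneg

lemma add (hf : BddOn p f) (hg : BddOn p g) : BddOn p fun x => f x + g x := by
  obtain ⟨B, hB⟩ := hf
  obtain ⟨B', hB'⟩ := hg
  exact ⟨B + B', fun x hx => (abs_add_le _ _).trans (add_le_add (hB x hx) (hB' x hx))⟩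

lemma const_mul (a : ℝ) (hf : BddOn p f) : BddOn p fun x => a * f x := by
  obtain ⟨B, hB⟩ := hf
  refine ⟨|a| * B, fun x hx => ?_⟩
  rw [abs_mul]
  exact mul_le_mul_of_nonneg_left (hB x hx) (abs_nonneg a)

lemma sub (hf : BddOn p f) (hg : BddOn p g) : BddOn p fun x => f x - g x := by
  simpa [sub_eq_add_neg] using hf.add (hg.const_mul (-1))

lemma exp (hf : BddOn p f) : BddOn p fun x => Real.exp (f x) := by
  obtain ⟨B, hB⟩ := hf
  refine ⟨Real.exp B, fun x hx => ?_⟩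
  rw [Real.abs_exp, Real.exp_le_exp]
  exact (le_abs_self _).trans (hB x hx)

lemma sq (hf : BddOn p f) : BddOn p fun x => f x ^ 2 := by
  obtain ⟨B, hB⟩ := hf
  refine ⟨B ^ 2, fun x hx => ?_⟩
  rw [abs_pow]
  exact pow_le_pow_left₀ (abs_nonneg _) (hB x hx) 2

lemma const (p : PMF X) (a : ℝ) : BddOn p fun _ => a := ⟨|a|, fun _ _ => le_rfl⟩

end BddOn

variable {p : PMF X} {f g : X → ℝ}

lemma expect_add (hf : BddOn p f) (hg : BddOn p g) :
    expect p (fun x => f x + g x) = expect p f + expect p g := by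
  simp only [expect, mul_add]
  exact hf.summable.tsum_add hg.summable

lemma expect_const_mul (p : PMF X) (a : ℝ) (f : X → ℝ) :
    expect p (fun x => a * f x) = a * expect p f := by
  simp only [expect, mul_left_comm _ a, tsum_mul_left]

lemma expect_sub (hf : BddOn p f) (hg : BddOn p g) :
    expect p (fun x => f x - g x) = expect p f - expect p g := by
  have h := expect_add hf (hg.const_mul (-1))
  rw [expect_const_mul] at h
  simpa [sub_eq_add_neg] using h

@[simp]
lemma expect_const (p : PMF X) (a : ℝ) : expect p (fun _ => a) = a := by
  rw [expect, tsum_mul_right, ← ENNReal.tsum_toReal_eq p.apply_ne_top, p.tsum_coe]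
  simp

lemma expect_congr (h : ∀ x ∈ p.support, f x = g x) : expect p f = expect p g := by
  refine tsum_congr fun x => ?_
  by_cases hx : p x = 0
  · simp [hx]
  · rw [h x ((p.mem_support_iff x).2 hx)]

lemma toReal_mul_nonneg (h : ∀ x ∈ p.support, 0 ≤ f x) (x : X) : 0 ≤ (p x).toReal * f x := by
  by_cases hx : p x = 0
  · simp [hx]
  · exact mul_nonneg ENNReal.toReal_nonneg (h x ((p.mem_support_iff x).2 hx))

lemma expect_nonneg (h : ∀ x ∈ p.support, 0 ≤ f x) : 0 ≤ expect p f :=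
  tsum_nonneg (toReal_mul_nonneg h)

lemma expect_mono (hf : BddOn p f) (hg : BddOn p g) (h : ∀ x ∈ p.support, f x ≤ g x) :
    expect p f ≤ expect p g := by
  have := expect_nonneg (p := p) (f := fun x => g x - f x) fun x hx => sub_nonneg.2 (h x hx)
  rw [expect_sub hg hf] at this
  linarith

lemma expect_le_const (hf : BddOn p f) {a : ℝ} (h : ∀ x ∈ p.support, f x ≤ a) :
    expect p f ≤ a :=
  (expect_mono hf (BddOn.const p a) h).trans_eq (expect_const p a)

lemma eq_zero_of_expect_nonpos (hf : BddOn p f) (h0 : ∀ x ∈ p.support, 0 ≤ f x)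
    (h : expect p f ≤ 0) : ∀ x ∈ p.support, f x = 0 := by
  intro x hx
  have hterm : (p x).toReal * f x ≤ 0 :=
    (hf.summable.le_tsum x fun y _ => toReal_mul_nonneg h0 y).trans h
  have hpos : 0 < (p x).toReal :=
    ENNReal.toReal_pos ((p.mem_support_iff x).1 hx) (p.apply_ne_top x)
  nlinarith [h0 x hx]

lemma eexpect_ofReal (hf : BddOn p f) (h0 : ∀ x ∈ p.support, 0 ≤ f x) :
    eexpect p (fun x => ENNReal.ofReal (f x)) = ENNReal.ofReal (expect p f) := by
  rw [expect, ENNReal.ofReal_tsum_of_nonneg (toReal_mul_nonneg h0) hf.summable, eexpect]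
  refine tsum_congr fun x => ?_
  rw [ENNReal.ofReal_mul ENNReal.toReal_nonneg, ENNReal.ofReal_toReal (p.apply_ne_top x)]

lemma expect_eq_toReal_eexpect {B : ℝ} (hB : ∀ x ∈ p.support, |f x| ≤ B) :
    expect p f = (eexpect p fun x => ENNReal.ofReal (f x + B)).toReal - B := by
  have hf : BddOn p f := ⟨B, hB⟩
  have h0 : ∀ x ∈ p.support, 0 ≤ f x + B := fun x hx => by linarith [neg_le_of_abs_le (hB x hx)]
  rw [eexpect_ofReal (hf.add (BddOn.const p B)) h0, ENNReal.toReal_ofReal (expect_nonneg h0),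
    expect_add hf (BddOn.const p B), expect_const]
  ring

lemma expect_map {g : Y → X} {q : PMF Y} (hf : BddOn (q.map g) f) :
    expect (q.map g) f = expect q fun y => f (g y) := by
  obtain ⟨B, hB⟩ := hf
  rw [expect_eq_toReal_eexpect hB, eexpect_map, expect_eq_toReal_eexpect (B := B)]
  exact fun y hy => hB _ ((PMF.mem_support_map_iff _ _ _).2 ⟨y, hy, rfl⟩)

lemma ae_mem_support [MeasurableSpace X] [DiscreteMeasurableSpace X] (p : PMF X) :
    ∀ᵐ x ∂p.toMeasure, x ∈ p.support := by
  rw [MeasureTheory.ae_iff]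
  exact (PMF.toMeasure_apply_eq_zero_iff p .of_discrete).2
    (Set.disjoint_left.2 fun x hx hx' => hx' hx)

lemma expect_eq_integral [MeasurableSpace X] [DiscreteMeasurableSpace X] (hf : BddOn p f) :
    expect p f = ∫ x, f x ∂p.toMeasure := by
  obtain ⟨B, hB⟩ := hf
  refine (PMF.integral_eq_tsum p f ?_).symm
  exact .of_bound (Measurable.of_discrete (f := f)).aestronglyMeasurable B
    ((ae_mem_support p).mono fun x hx => hB x hx)

/-- The equality case of Gibbs' inequality `E[u] ≤ log E[exp u]`. -/
lemma eq_zero_of_expect_exp_le_one (hf : BddOn p f) (h0 : 0 ≤ expect p f)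
    (h1 : expect p (fun x => Real.exp (f x)) ≤ 1) : ∀ x ∈ p.support, f x = 0 := by
  have hgap : expect p (fun x => Real.exp (f x) - (f x + 1)) ≤ 0 := by
    rw [expect_sub hf.exp (hf.add (.const p 1)), expect_add hf (.const p 1), expect_const]
    linarith
  intro x hx
  have h := eq_zero_of_expect_nonpos (hf.exp.sub (hf.add (.const p 1)))
    (fun y _ => sub_nonneg.2 (Real.add_one_le_exp _)) hgap x hx
  by_contra hne
  exact (Real.add_one_lt_exp hne).ne' (sub_eq_zero.1 h)

end Expectation

/-! ### Exponential moments and concentration -/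

section ExpMoment

variable {X Y ι : Type*} {p : PMF X}

/-- The exponential moment `E[exp f]`, as an extended nonnegative number. -/
def expMoment (p : PMF X) (f : X → ℝ) : ℝ≥0∞ := eexpect p fun x => ENNReal.ofReal (Real.exp (f x))

lemma expMoment_mono {f g : X → ℝ} (h : ∀ x ∈ p.support, f x ≤ g x) :
    expMoment p f ≤ expMoment p g :=
  eexpect_mono fun x hx => ENNReal.ofReal_le_ofReal (Real.exp_le_exp.2 (h x hx))

@[simp]
lemma expMoment_pure (a : X) (f : X → ℝ) :
    expMoment (PMF.pure a) f = ENNReal.ofReal (Real.exp (f a)) :=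
  eexpect_pure _ _

lemma expMoment_map (p : PMF X) (g : X → Y) (f : Y → ℝ) :
    expMoment (p.map g) f = expMoment p fun x => f (g x) :=
  eexpect_map _ _ _

lemma expMoment_const_add (p : PMF X) (a : ℝ) (f : X → ℝ) :
    expMoment p (fun x => a + f x) = ENNReal.ofReal (Real.exp a) * expMoment p f := by
  simp only [expMoment, Real.exp_add, ENNReal.ofReal_mul (Real.exp_pos a).le, eexpect_const_mul]

lemma expMoment_bind_le {q : X → PMF Y} {f : Y → ℝ} {g : X → ℝ}
    (h : ∀ x ∈ p.support, expMoment (q x) f ≤ ENNReal.ofReal (Real.exp (g x))) :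
    expMoment (p.bind q) f ≤ expMoment p g :=
  (eexpect_bind _ _ _).trans_le (eexpect_mono h)

lemma expMoment_bind_le_one {q : X → PMF Y} {f : Y → ℝ}
    (h : ∀ x ∈ p.support, expMoment (q x) f ≤ 1) : expMoment (p.bind q) f ≤ 1 :=
  (eexpect_bind _ _ _).trans_le (eexpect_le_const h)

lemma toOuterMeasure_lt_le_of_expMoment_le_one {f : X → ℝ} (h : expMoment p f ≤ 1) (ℓ : ℝ) :
    p.toOuterMeasure {x | ℓ < f x} ≤ ENNReal.ofReal (Real.exp (-ℓ)) := by
  rw [toOuterMeasure_eq_eexpect]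
  calc eexpect p ({x | ℓ < f x}.indicator fun _ => 1)
      ≤ expMoment p fun x => -ℓ + f x := by
        refine eexpect_mono fun x _ => Set.indicator_apply_le' (fun hx => ?_) fun _ => zero_le
        rw [ENNReal.one_le_ofReal, Real.one_le_exp_iff]
        exact le_neg_add_iff_add_le.2 (by simpa using le_of_lt hx)
    _ = ENNReal.ofReal (Real.exp (-ℓ)) * expMoment p f := expMoment_const_add _ _ _
    _ ≤ ENNReal.ofReal (Real.exp (-ℓ)) := mul_le_of_le_one_right' h

lemma toOuterMeasure_exists_lt_le_of_expMoment_le_one {s : Finset ι} {f : ι → X → ℝ}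
    (h : ∀ i ∈ s, expMoment p (f i) ≤ 1) (ℓ : ℝ) :
    p.toOuterMeasure {x | ∃ i ∈ s, ℓ < f i x} ≤ s.card * ENNReal.ofReal (Real.exp (-ℓ)) := by
  have hunion : {x | ∃ i ∈ s, ℓ < f i x} = ⋃ i ∈ s, {x | ℓ < f i x} := by ext; simp
  rw [hunion, ← nsmul_eq_mul]
  exact (MeasureTheory.measure_biUnion_finset_le s _).trans
    (Finset.sum_le_card_nsmul _ _ _ fun i hi =>
      toOuterMeasure_lt_le_of_expMoment_le_one (h i hi) ℓ)

/-- The exponent `∑ (l (E[f] - f x) - l² B² / 2)` of Hoeffding's exponential supermartingale for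
samples `x` from `p` and a function `f` with values in `[-B, B]`. -/
def hoeffdingExponent (p : PMF X) (f : X → ℝ) (B l : ℝ) (xs : List X) : ℝ :=
  (xs.map fun x => l * (expect p f - f x) - l ^ 2 * B ^ 2 / 2).sum

lemma hoeffdingExponent_eq (p : PMF X) (f : X → ℝ) (B l : ℝ) (xs : List X) :
    hoeffdingExponent p f B l xs =
      l * (xs.length * expect p f - (xs.map f).sum) - xs.length * (l ^ 2 * B ^ 2 / 2) := by
  induction xs with
  | nil => simp [hoeffdingExponent]
  | cons x xs ih =>
    rw [hoeffdingExponent] at ih ⊢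
    simp only [List.map_cons, List.sum_cons, List.length_cons, Nat.cast_succ, ih]
    ring

lemma expect_le_of_hoeffdingExponent_le {f : X → ℝ} {B ℓ : ℝ} {xs : List X} (hB : 0 < B)
    (hℓ : 0 < ℓ) (hxs : 0 < xs.length)
    (h : hoeffdingExponent p f B (2 * √(ℓ / xs.length) / B) xs ≤ 2 * ℓ) :
    expect p f ≤ (xs.map f).sum / xs.length + 2 * B * √(ℓ / xs.length) := by
  set n : ℝ := (xs.length : ℝ)
  set s := √(ℓ / n)
  have hn : 0 < n := Nat.cast_pos.2 hxs
  have hs : 0 < s := Real.sqrt_pos.2 (div_pos hℓ hn)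
  have hsq : n * s ^ 2 = ℓ := by rw [Real.sq_sqrt (div_pos hℓ hn).le, mul_div_cancel₀ _ hn.ne']
  have hquad : n * ((2 * s / B) ^ 2 * B ^ 2 / 2) = 2 * ℓ := by
    rw [← hsq]
    field_simp
  have hlin : 2 * s / B * (n * expect p f - (xs.map f).sum) ≤ 2 * s / B * (n * (2 * B * s)) := by
    have hfour : 2 * s / B * (n * (2 * B * s)) = 4 * ℓ := by
      rw [← hsq]
      field_simp
      ring
    rw [hoeffdingExponent_eq, hquad] at h
    linarith
  have hdev := le_of_mul_le_mul_left hlin (by positivity)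
  rw [← sub_le_iff_le_add', ← mul_le_mul_iff_right₀ hn, mul_sub, mul_div_cancel₀ _ hn.ne']
  exact hdev

lemma expMoment_hoeffding_le_one {f : X → ℝ} {B : ℝ} (hB : ∀ x ∈ p.support, |f x| ≤ B) (l : ℝ) :
    expMoment p (fun x => l * (expect p f - f x) - l ^ 2 * B ^ 2 / 2) ≤ 1 := by
  let _ : MeasurableSpace X := ⊤
  have hf : BddOn p f := ⟨B, hB⟩
  have hdev : BddOn p fun x => l * (expect p f - f x) - l ^ 2 * B ^ 2 / 2 :=
    (((BddOn.const p _).sub hf).const_mul l).sub (.const p _)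
  have hmgf := (ProbabilityTheory.hasSubgaussianMGF_of_mem_Icc (μ := p.toMeasure) (X := f)
    (a := -B) (b := B) Measurable.of_discrete.aemeasurable
    ((ae_mem_support p).mono fun x hx => abs_le.1 (hB x hx))).mgf_le (-l)
  rw [ProbabilityTheory.mgf, ← expect_eq_integral hf] at hmgf
  rw [expMoment, eexpect_ofReal hdev.exp fun x _ => (Real.exp_pos _).le, ENNReal.ofReal_le_one,
    expect_eq_integral hdev.exp]
  calc ∫ x, Real.exp (l * (expect p f - f x) - l ^ 2 * B ^ 2 / 2) ∂p.toMeasure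
      = Real.exp (-(l ^ 2 * B ^ 2 / 2)) *
          ∫ x, Real.exp (-l * (f x - expect p f)) ∂p.toMeasure := by
        rw [← MeasureTheory.integral_const_mul]
        congr 1 with x
        rw [← Real.exp_add]
        ring_nf
    _ ≤ Real.exp (-(l ^ 2 * B ^ 2 / 2)) * Real.exp (l ^ 2 * B ^ 2 / 2) := by
        gcongr
        refine hmgf.trans_eq ?_
        congr 1
        push_cast
        rw [Real.norm_eq_abs, div_pow, sq_abs]
        ring
    _ = 1 := by rw [← Real.exp_add, neg_add_cancel, Real.exp_zero]

lemma expMoment_hoeffdingExponent_concat_le {f : X → ℝ} {B : ℝ}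
    (hB : ∀ x ∈ p.support, |f x| ≤ B) (l : ℝ) (xs : List X) :
    expMoment p (fun x => hoeffdingExponent p f B l (xs ++ [x])) ≤
      ENNReal.ofReal (Real.exp (hoeffdingExponent p f B l xs)) := by
  simp only [hoeffdingExponent, List.map_append, List.sum_append, List.map_singleton,
    List.sum_singleton, expMoment_const_add]
  exact mul_le_of_le_one_right' (expMoment_hoeffding_le_one hB l)

lemma expMoment_iid_hoeffdingExponent_le_one {f : X → ℝ} {B : ℝ}
    (hB : ∀ x ∈ p.support, |f x| ≤ B) (l : ℝ) (n : ℕ) :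
    expMoment (iid p n) (hoeffdingExponent p f B l) ≤ 1 := by
  induction n with
  | zero => simp [iid, hoeffdingExponent]
  | succ n ih =>
    refine (expMoment_bind_le fun x _ => ?_).trans (expMoment_hoeffding_le_one hB l)
    simp only [expMoment_map, hoeffdingExponent, List.map_cons, List.sum_cons,
      expMoment_const_add]
    exact mul_le_of_le_one_right' ih

lemma mem_support_iid {n : ℕ} {l : List X} (h : l ∈ (iid p n).support) :
    l.length = n ∧ ∀ x ∈ l, x ∈ p.support := by
  induction n generalizing l with
  | zero =>
    simp only [iid, PMF.mem_support_pure_iff] at h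
    simp [h]
  | succ n ih =>
    simp only [iid, PMF.mem_support_bind_iff, PMF.mem_support_map_iff] at h
    obtain ⟨x, hx, l, hl, rfl⟩ := h
    obtain ⟨hlen, hmem⟩ := ih hl
    refine ⟨by simp [hlen], fun z hz => ?_⟩
    rcases List.mem_cons.1 hz with rfl | hz
    · exact hx
    · exact hmem z hz

end ExpMoment

section Trajectories

variable {S A : Type*} {H : ℕ}

/-! ### Trajectory distributions -/

@[simp]
lemma polProb_nil (π : Policy S A) : polProb π [] = 1 := by simp [polProb]

lemma polProb_cons (π : Policy S A) (x : S × A) (τ : Traj S A) :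
    polProb π (x :: τ) = (π x.1 x.2).toReal * polProb π τ := by
  simp [polProb]

lemma polProb_nonneg (π : Policy S A) (τ : Traj S A) : 0 ≤ polProb π τ :=
  List.prod_nonneg fun a ha => by
    obtain ⟨x, -, rfl⟩ := List.mem_map.1 ha
    exact ENNReal.toReal_nonneg

namespace DCMDP

variable (M : DCMDP S A H)

/-- The two trajectories are admissible and start from the same initial state: the pairs of
responses that the algorithm may have to compare. -/
def AdmissiblePair (x : Traj S A × Traj S A) : Prop :=
  ∃ s ∈ M.init.support, ∃ as as' : List A, as.length = H ∧ as'.length = H ∧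
    x = (M.path s as, M.path s as')

variable {M}

lemma AdmissiblePair.fst {x : Traj S A × Traj S A} (h : M.AdmissiblePair x) :
    M.Admissible x.1 := by
  obtain ⟨s, hs, as, _, ha, -, rfl⟩ := h
  exact ⟨s, hs, as, ha, rfl⟩

lemma AdmissiblePair.snd {x : Traj S A × Traj S A} (h : M.AdmissiblePair x) :
    M.Admissible x.2 := by
  obtain ⟨s, hs, _, as, -, ha, rfl⟩ := h
  exact ⟨s, hs, as, ha, rfl⟩

variable (M)

lemma exists_path_of_mem_support_rollout (π : Policy S A) (n : ℕ) (s : S) (τ : Traj S A)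
    (h : τ ∈ (M.rollout π n s).support) : ∃ as : List A, as.length = n ∧ τ = M.path s as := by
  induction n generalizing s τ with
  | zero =>
    refine ⟨[], rfl, ?_⟩
    simpa [rollout, path] using h
  | succ n ih =>
    simp only [rollout, PMF.mem_support_bind_iff, PMF.mem_support_map_iff] at h
    obtain ⟨a, -, τ', hτ', rfl⟩ := h
    obtain ⟨as, rfl, rfl⟩ := ih _ _ hτ'
    exact ⟨a :: as, rfl, rfl⟩

lemma path_mem_support_rollout (π : Policy S A) (as : List A) (s : S)
    (h : 0 < polProb π (M.path s as)) : M.path s as ∈ (M.rollout π as.length s).support := by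
  induction as generalizing s with
  | nil => simp [rollout, path]
  | cons a as ih =>
    rw [path, polProb_cons] at h
    have htail : 0 < polProb π (M.path (M.next s a) as) :=
      (polProb_nonneg _ _).lt_of_ne fun h0 => by simp [← h0] at h
    have hhead : π s a ≠ 0 := fun h0 => by simp [h0] at h
    simp only [rollout, List.length_cons, PMF.mem_support_bind_iff, PMF.mem_support_map_iff]
    exact ⟨a, (PMF.mem_support_iff _ _).2 hhead, _, ih _ htail, rfl⟩

lemma exists_path_of_mem_support_response (ν : MixedPolicy S A) (s : S) (τ : Traj S A)
    (h : τ ∈ (M.response ν s).support) : ∃ as : List A, as.length = H ∧ τ = M.path s as := by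
  simp only [response, PMF.mem_support_bind_iff] at h
  obtain ⟨π, -, h⟩ := h
  exact M.exists_path_of_mem_support_rollout π H s τ h

lemma admissible_of_mem_support_trajLaw {ν : MixedPolicy S A} {τ : Traj S A}
    (h : τ ∈ (M.trajLaw ν).support) : M.Admissible τ := by
  simp only [trajLaw, PMF.mem_support_bind_iff] at h
  obtain ⟨s, hs, h⟩ := h
  exact ⟨s, hs, M.exists_path_of_mem_support_response ν s τ h⟩

lemma mem_support_trajLaw {π : Policy S A} {τ : Traj S A} (h : M.Admissible τ)
    (hp : 0 < polProb π τ) : τ ∈ (M.trajLaw (PMF.pure π)).support := by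
  obtain ⟨s, hs, as, rfl, rfl⟩ := h
  simp only [trajLaw, response, PMF.pure_bind, PMF.mem_support_bind_iff]
  exact ⟨s, hs, M.path_mem_support_rollout π as s hp⟩

lemma admissiblePair_of_mem_support_pairLaw {π : Policy S A} {ν : MixedPolicy S A}
    {x : Traj S A × Traj S A} (h : x ∈ (M.pairLaw π ν).support) : M.AdmissiblePair x := by
  simp only [pairLaw, PMF.mem_support_bind_iff, PMF.mem_support_map_iff] at h
  obtain ⟨s, hs, τ, hτ, τ', hτ', rfl⟩ := h
  obtain ⟨as, has, rfl⟩ := M.exists_path_of_mem_support_rollout π H s τ hτ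
  obtain ⟨as', has', rfl⟩ := M.exists_path_of_mem_support_response ν s τ' hτ'
  exact ⟨s, hs, as, as', has, has', rfl⟩

lemma pairLaw_map_fst (π : Policy S A) (ν : MixedPolicy S A) :
    (M.pairLaw π ν).map Prod.fst = M.trajLaw (PMF.pure π) := by
  simp only [pairLaw, trajLaw, response, PMF.map_bind, PMF.pure_bind, PMF.map_comp]
  congr 1 with s : 1
  have hfst : ∀ τ : Traj S A, Prod.fst ∘ (fun τ' : Traj S A => (τ, τ')) = Function.const _ τ :=
    fun τ => rfl
  simp only [hfst, PMF.map_const, PMF.bind_pure, PMF.bind_const]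

lemma pairLaw_map_snd (π : Policy S A) (ν : MixedPolicy S A) :
    (M.pairLaw π ν).map Prod.snd = M.trajLaw ν := by
  simp only [pairLaw, trajLaw, PMF.map_bind, PMF.map_comp]
  congr 1 with s : 1
  have hsnd : ∀ τ : Traj S A, Prod.snd ∘ (fun τ' : Traj S A => (τ, τ')) = id := fun τ => rfl
  simp only [hsnd, PMF.map_id, PMF.bind_const]

lemma exists_admissible (π : Policy S A) : ∃ τ, M.Admissible τ := by
  obtain ⟨τ, hτ⟩ := (M.trajLaw (PMF.pure π)).support_nonempty
  exact ⟨τ, M.admissible_of_mem_support_trajLaw hτ⟩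

/-- The function `f` is bounded on admissible trajectories, hence has an expectation under every
trajectory distribution of `M`. -/
def BddTraj (f : Traj S A → ℝ) : Prop := ∃ B, ∀ τ, M.Admissible τ → |f τ| ≤ B

variable {M}

lemma BddTraj.bddOn {f : Traj S A → ℝ} (h : M.BddTraj f) (ν : MixedPolicy S A) :
    BddOn (M.trajLaw ν) f := by
  obtain ⟨B, hB⟩ := h
  exact ⟨B, fun τ hτ => hB τ (M.admissible_of_mem_support_trajLaw hτ)⟩

lemma BddTraj.bddOn_fst {f : Traj S A → ℝ} (h : M.BddTraj f) (π : Policy S A)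
    (ν : MixedPolicy S A) : BddOn (M.pairLaw π ν) fun x => f x.1 := by
  obtain ⟨B, hB⟩ := h
  exact ⟨B, fun τ hτ => hB _ (M.admissiblePair_of_mem_support_pairLaw hτ).fst⟩

lemma BddTraj.bddOn_snd {f : Traj S A → ℝ} (h : M.BddTraj f) (π : Policy S A)
    (ν : MixedPolicy S A) : BddOn (M.pairLaw π ν) fun x => f x.2 := by
  obtain ⟨B, hB⟩ := h
  exact ⟨B, fun τ hτ => hB _ (M.admissiblePair_of_mem_support_pairLaw hτ).snd⟩

lemma expect_pairLaw_fst {f : Traj S A → ℝ} (h : M.BddTraj f) (π : Policy S A)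
    (ν : MixedPolicy S A) :
    expect (M.pairLaw π ν) (fun x => f x.1) = expect (M.trajLaw (PMF.pure π)) f := by
  rw [← M.pairLaw_map_fst π ν, expect_map (M.pairLaw_map_fst π ν ▸ h.bddOn _)]

lemma expect_pairLaw_snd {f : Traj S A → ℝ} (h : M.BddTraj f) (π : Policy S A)
    (ν : MixedPolicy S A) :
    expect (M.pairLaw π ν) (fun x => f x.2) = expect (M.trajLaw ν) f := by
  rw [← M.pairLaw_map_snd π ν, expect_map (M.pairLaw_map_snd π ν ▸ h.bddOn _)]

end DCMDP

end Trajectories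

/-! ### Regularized rewards and discrepancies -/

section Discrepancy

variable {S A : Type*} {H : ℕ} {M : DCMDP S A H} {πref π π' πstar : Policy S A}
  {Pol : Finset (Policy S A)} {β V R : ℝ}

namespace DCMDP

lemma BoundedReturn.abs_ret_le (hR : M.BoundedReturn R) {τ : Traj S A} (hτ : M.Admissible τ) :
    |M.ret τ| ≤ R := by
  rw [abs_of_nonneg (hR τ hτ).1]
  exact (hR τ hτ).2

lemma BoundedRatio.abs_mul_logRatio_le (hV : M.BoundedRatio πref Pol β V) (hβ : 0 < β)
    (hπ : π ∈ Pol) {τ : Traj S A} (hτ : M.Admissible τ) : |β * logRatio π πref τ| ≤ V := by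
  rw [abs_mul, abs_of_pos hβ, ← le_div_iff₀' hβ]
  exact (hV π hπ τ hτ).2.2

lemma BoundedRatio.nonneg (hV : M.BoundedRatio πref Pol β V) (hβ : 0 < β) (hπ : π ∈ Pol) :
    0 ≤ V := by
  obtain ⟨τ, hτ⟩ := M.exists_admissible π
  exact (abs_nonneg _).trans (hV.abs_mul_logRatio_le hβ hπ hτ)

lemma BoundedRatio.log_polProb_sub (hV : M.BoundedRatio πref Pol β V) (hπ : π ∈ Pol)
    (hπ' : π' ∈ Pol) {τ : Traj S A} (hτ : M.Admissible τ) :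
    Real.log (polProb π τ) - Real.log (polProb π' τ) =
      logRatio π πref τ - logRatio π' πref τ := by
  obtain ⟨href, hpos, -⟩ := hV π hπ τ hτ
  obtain ⟨-, hpos', -⟩ := hV π' hπ' τ hτ
  rw [logRatio, logRatio, Real.log_div hpos.ne' href.ne', Real.log_div hpos'.ne' href.ne']
  ring

lemma BoundedReturn.abs_klReward_le (hR : M.BoundedReturn R) (hV : M.BoundedRatio πref Pol β V)
    (hβ : 0 < β) (hπ : π ∈ Pol) {τ : Traj S A} (hτ : M.Admissible τ) :
    |M.klReward πref β π τ| ≤ V + R :=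
  (abs_sub _ _).trans <| add_comm V R ▸
    add_le_add (hR.abs_ret_le hτ) (hV.abs_mul_logRatio_le hβ hπ hτ)

lemma BoundedReturn.bddTraj_klReward (hR : M.BoundedReturn R) (hV : M.BoundedRatio πref Pol β V)
    (hβ : 0 < β) (hπ : π ∈ Pol) : M.BddTraj (M.klReward πref β π) :=
  ⟨V + R, fun _ hτ => hR.abs_klReward_le hV hβ hπ hτ⟩

lemma BoundedReturn.abs_discrepancy_le (hR : M.BoundedReturn R) (hV : M.BoundedRatio πref Pol β V)
    (hβ : 0 < β) (hπ : π ∈ Pol) {x : Traj S A × Traj S A} (hx : M.AdmissiblePair x) :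
    |M.discrepancy πref β π x| ≤ 2 * (V + R) := by
  have hfst := abs_le.1 (hV.abs_mul_logRatio_le hβ hπ hx.fst)
  have hsnd := abs_le.1 (hV.abs_mul_logRatio_le hβ hπ hx.snd)
  have hret := abs_le.1 (hR.abs_ret_le hx.fst)
  have hret' := abs_le.1 (hR.abs_ret_le hx.snd)
  rw [discrepancy, abs_le]
  constructor <;> linarith

lemma discrepancy_eq_klReward_sub (M : DCMDP S A H) (πref : Policy S A) (β : ℝ) (π : Policy S A)
    (x : Traj S A × Traj S A) :
    M.discrepancy πref β π x = M.klReward πref β π x.2 - M.klReward πref β π x.1 := by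
  simp only [discrepancy, klReward]
  ring

lemma expect_discrepancy (h : M.BddTraj (M.klReward πref β π)) (ν : MixedPolicy S A) :
    expect (M.pairLaw π ν) (M.discrepancy πref β π) =
      expect (M.trajLaw ν) (M.klReward πref β π) - M.J πref β π := by
  rw [J, ← expect_pairLaw_snd h π ν, ← expect_pairLaw_fst h π ν,
    ← expect_sub (h.bddOn_snd π ν) (h.bddOn_fst π ν)]
  exact expect_congr fun x _ => M.discrepancy_eq_klReward_sub πref β π x

/-- The log-ratio of `π` reproduces return differences between responses to the same initial state,
so that DPO's implicit reward is the true one. This is how the optimality of `π⋆` gets used. -/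
def IsCalibrated (M : DCMDP S A H) (πref : Policy S A) (β : ℝ) (π : Policy S A) : Prop :=
  ∀ x, M.AdmissiblePair x → M.discrepancy πref β π x = 0

lemma IsCalibrated.expect_klReward (hcal : M.IsCalibrated πref β π)
    (h : M.BddTraj (M.klReward πref β π)) (ν : MixedPolicy S A) :
    expect (M.trajLaw ν) (M.klReward πref β π) = M.J πref β π := by
  have hzero := expect_congr fun x hx =>
    hcal x (M.admissiblePair_of_mem_support_pairLaw (π := π) (ν := ν) hx)
  rw [expect_discrepancy h ν, expect_const, sub_eq_zero] at hzero
  exact hzero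

lemma IsCalibrated.of_boundedRatio_zero (hcal : M.IsCalibrated πref β πstar)
    (hV : M.BoundedRatio πref Pol β 0) (hβ : 0 < β) (hπ : π ∈ Pol) (hstar : πstar ∈ Pol) :
    M.IsCalibrated πref β π := by
  intro x hx
  have hzero : ∀ π ∈ Pol, ∀ τ, M.Admissible τ → β * logRatio π πref τ = 0 :=
    fun π hπ τ hτ => abs_nonpos_iff.1 (hV.abs_mul_logRatio_le hβ hπ hτ)
  have h := hcal x hx
  simp only [discrepancy] at h ⊢
  rw [hzero πstar hstar _ hx.fst, hzero πstar hstar _ hx.snd] at h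
  rw [hzero π hπ _ hx.fst, hzero π hπ _ hx.snd, h]

/-- The difference `β log (π(τ) / π'(τ))` of the implicit rewards of two policies, written with
density ratios against `π_ref` because those are the quantities assumed to be bounded. -/
def ratioGap (πref : Policy S A) (β : ℝ) (π π' : Policy S A) (τ : Traj S A) : ℝ :=
  β * logRatio π πref τ - β * logRatio π' πref τ

lemma BoundedRatio.abs_ratioGap_le (hV : M.BoundedRatio πref Pol β V) (hβ : 0 < β)
    (hπ : π ∈ Pol) (hπ' : π' ∈ Pol) {τ : Traj S A} (hτ : M.Admissible τ) :
    |ratioGap πref β π π' τ| ≤ 2 * V := by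
  refine (abs_sub _ _).trans ?_
  linarith [hV.abs_mul_logRatio_le hβ hπ hτ, hV.abs_mul_logRatio_le hβ hπ' hτ]

lemma IsCalibrated.J_sub_J_eq (hcal : M.IsCalibrated πref β πstar)
    (hstar : M.BddTraj (M.klReward πref β πstar)) (hπ : M.BddTraj (M.klReward πref β π))
    (ν : MixedPolicy S A) :
    M.J πref β πstar - M.J πref β π = expect (M.pairLaw π ν) (M.discrepancy πref β π) +
      expect (M.trajLaw ν) (ratioGap πref β π πstar) := by
  have hgap : expect (M.trajLaw ν) (ratioGap πref β π πstar) =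
      expect (M.trajLaw ν) (M.klReward πref β πstar) -
        expect (M.trajLaw ν) (M.klReward πref β π) := by
    rw [← expect_sub (hstar.bddOn ν) (hπ.bddOn ν)]
    exact expect_congr fun x _ => by simp only [klReward, ratioGap]; ring
  rw [hgap, expect_discrepancy hπ ν, hcal.expect_klReward hstar ν]
  ring

lemma BoundedReturn.J_ref_nonneg (hR : M.BoundedReturn R)
    (href : ∀ τ, M.Admissible τ → 0 < polProb πref τ) : 0 ≤ M.J πref β πref := by
  refine expect_nonneg fun τ hτ => ?_
  have hτ' := M.admissible_of_mem_support_trajLaw hτ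
  rw [klReward, logRatio, div_self (href τ hτ').ne', Real.log_one, mul_zero, sub_zero]
  exact (hR τ hτ').1

lemma BoundedReturn.J_le (hR : M.BoundedReturn R) (hV : M.BoundedRatio πref Pol β V) (hβ : 0 < β)
    (hπ : π ∈ Pol) : M.J πref β π ≤ V + R :=
  expect_le_const ((hR.bddTraj_klReward hV hβ hπ).bddOn _) fun _ hτ => (le_abs_self _).trans
    (hR.abs_klReward_le hV hβ hπ (M.admissible_of_mem_support_trajLaw hτ))

end DCMDP

end Discrepancy

/-! ### The optimal policy -/

section Gibbs

variable {S A : Type*} {H : ℕ}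

namespace DCMDP

variable (M : DCMDP S A H)

/-- The exponentially weighted return `exp (r(τ) / β)`. -/
def expReturn (β : ℝ) (τ : Traj S A) : ℝ≥0∞ := ENNReal.ofReal (Real.exp (M.ret τ / β))

/-- The partition function: expectation of `exp (r(τ) / β)` over `n` steps of `π_ref`. It is
extended-valued because returns of partial trajectories need not be bounded. -/
def partitionFn (πref : Policy S A) (β : ℝ) (n : ℕ) (s : S) : ℝ≥0∞ :=
  eexpect (M.rollout πref n s) (M.expReturn β)

/-- The unnormalized Gibbs weights of the actions in state `s`, with `n + 1` steps to go. -/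
def gibbsWeight (πref : Policy S A) (β : ℝ) (n : ℕ) (s : S) (a : A) : ℝ≥0∞ :=
  πref s a * (ENNReal.ofReal (Real.exp (M.reward s a / β)) *
    M.partitionFn πref β n (M.next s a))

variable {M} {πref π π' πstar : Policy S A} {β V R : ℝ} {Pol : Finset (Policy S A)}

lemma ret_cons (x : S × A) (τ : Traj S A) : M.ret (x :: τ) = M.reward x.1 x.2 + M.ret τ := by
  simp [ret]

lemma expReturn_cons (β : ℝ) (x : S × A) (τ : Traj S A) :
    M.expReturn β (x :: τ) =
      ENNReal.ofReal (Real.exp (M.reward x.1 x.2 / β)) * M.expReturn β τ := by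
  rw [expReturn, expReturn, ← ENNReal.ofReal_mul (Real.exp_pos _).le, ← Real.exp_add, ret_cons,
    add_div]

lemma partitionFn_succ (πref : Policy S A) (β : ℝ) (n : ℕ) (s : S) :
    M.partitionFn πref β (n + 1) s = ∑' a, M.gibbsWeight πref β n s a := by
  simp only [partitionFn, rollout, eexpect_bind, eexpect_map, expReturn_cons, eexpect_const_mul]
  rfl

lemma partitionFn_ne_zero (πref : Policy S A) (β : ℝ) (n : ℕ) (s : S) :
    M.partitionFn πref β n s ≠ 0 := by
  obtain ⟨τ, hτ⟩ := (M.rollout πref n s).support_nonempty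
  rw [partitionFn, eexpect, ne_eq, ENNReal.tsum_eq_zero, not_forall]
  refine ⟨τ, mul_ne_zero ((PMF.mem_support_iff _ _).1 hτ) ?_⟩
  simp [expReturn, Real.exp_pos]

variable (M) in
/-- The Gibbs policy `π(a ∣ s) ∝ π_ref(a ∣ s) exp (r(s, a) / β) Z(s')`, whose trajectory law is
`π_ref` reweighted by `exp (r(τ) / β)`. Where the normalization diverges it is set to `π_ref`. -/
def gibbsPolicy (πref : Policy S A) (β : ℝ) : Policy S A := fun s =>
  open Classical in
  if h : (∑' a, M.gibbsWeight πref β (H - M.layer s - 1) s a) ≠ ⊤ then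
    PMF.normalize (M.gibbsWeight πref β (H - M.layer s - 1) s)
      (by rw [← partitionFn_succ]; exact partitionFn_ne_zero _ _ _ _) h
  else πref s

lemma gibbsPolicy_mul_partitionFn {n : ℕ} {s : S}
    (hn : (M.layer s : ℕ) + (n + 1) = H) (hZ : M.partitionFn πref β (n + 1) s ≠ ⊤) (a : A) :
    M.gibbsPolicy πref β s a * M.partitionFn πref β (n + 1) s = M.gibbsWeight πref β n s a := by
  have hsteps : H - M.layer s - 1 = n := by omega
  have h : (∑' a, M.gibbsWeight πref β (H - M.layer s - 1) s a) ≠ ⊤ := by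
    rwa [hsteps, ← partitionFn_succ]
  rw [gibbsPolicy, dif_pos h, PMF.normalize_apply, hsteps, ← partitionFn_succ, mul_assoc,
    ENNReal.inv_mul_cancel (partitionFn_ne_zero _ _ _ _) hZ, mul_one]

lemma partitionFn_next_ne_top {n : ℕ} {s : S} {a : A} (ha : πref s a ≠ 0)
    (hZ : M.partitionFn πref β (n + 1) s ≠ ⊤) : M.partitionFn πref β n (M.next s a) ≠ ⊤ := by
  intro htop
  rw [partitionFn_succ] at hZ
  refine ENNReal.ne_top_of_tsum_ne_top hZ a ?_
  rw [gibbsWeight, htop, ENNReal.mul_top (by simp [Real.exp_pos]), ENNReal.mul_top ha]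

lemma layer_next_add_length {s : S} {a : A} {as : List A} (has : as ≠ [])
    (h : (M.layer s : ℕ) + (as.length + 1) = H) :
    (M.layer (M.next s a) : ℕ) + as.length = H := by
  have hlen := List.length_pos_iff.2 has
  rw [M.layer_next s a (by omega)]
  omega

lemma polProb_gibbsPolicy_mul (as : List A) (s : S)
    (hlayer : as ≠ [] → (M.layer s : ℕ) + as.length = H)
    (hZ : M.partitionFn πref β as.length s ≠ ⊤) (hpos : 0 < polProb πref (M.path s as)) :
    polProb (M.gibbsPolicy πref β) (M.path s as) * (M.partitionFn πref β as.length s).toReal =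
      polProb πref (M.path s as) * Real.exp (M.ret (M.path s as) / β) := by
  induction as generalizing s with
  | nil => simp [path, partitionFn, rollout, expReturn, ret]
  | cons a as ih =>
    rw [path, polProb_cons] at hpos
    have htail : 0 < polProb πref (M.path (M.next s a) as) :=
      (polProb_nonneg _ _).lt_of_ne fun h0 => by simp [← h0] at hpos
    have hhead : πref s a ≠ 0 := fun h0 => by simp [h0] at hpos
    have hlayer := hlayer (List.cons_ne_nil _ _)
    have hrec := ih (M.next s a) (fun has => layer_next_add_length has hlayer)
      (partitionFn_next_ne_top hhead hZ) htail
    have hstep : (M.gibbsPolicy πref β s a).toReal *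
        (M.partitionFn πref β (as.length + 1) s).toReal = (πref s a).toReal *
          (Real.exp (M.reward s a / β) * (M.partitionFn πref β as.length (M.next s a)).toReal) := by
      rw [← ENNReal.toReal_mul, gibbsPolicy_mul_partitionFn hlayer hZ, gibbsWeight,
        ENNReal.toReal_mul, ENNReal.toReal_mul, ENNReal.toReal_ofReal (Real.exp_pos _).le]
    rw [path, polProb_cons, polProb_cons, ret_cons, add_div, Real.exp_add, List.length_cons]
    linear_combination (polProb (M.gibbsPolicy πref β) (M.path (M.next s a) as)) * hstep +
      (πref s a).toReal * Real.exp (M.reward s a / β) * hrec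

lemma BoundedReturn.partitionFn_mem_Icc (hR : M.BoundedReturn R) (hβ : 0 < β) {s : S}
    (hs : s ∈ M.init.support) :
    M.partitionFn πref β H s ∈ Set.Icc 1 (ENNReal.ofReal (Real.exp (R / β))) := by
  have hret : ∀ τ ∈ (M.rollout πref H s).support, M.ret τ ∈ Set.Icc 0 R := fun τ hτ =>
    hR τ ⟨s, hs, M.exists_path_of_mem_support_rollout πref H s τ hτ⟩
  constructor
  · rw [← eexpect_const (M.rollout πref H s) 1]
    refine eexpect_mono fun τ hτ => ?_
    rw [expReturn, ENNReal.one_le_ofReal, Real.one_le_exp_iff]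
    exact div_nonneg (hret τ hτ).1 hβ.le
  · refine eexpect_le_const fun τ hτ => ENNReal.ofReal_le_ofReal (Real.exp_le_exp.2 ?_)
    gcongr
    exact (hret τ hτ).2

lemma BoundedReturn.partitionFn_ne_top (hR : M.BoundedReturn R) (hβ : 0 < β) {s : S}
    (hs : s ∈ M.init.support) : M.partitionFn πref β H s ≠ ⊤ :=
  ne_top_of_le_ne_top ENNReal.ofReal_ne_top (hR.partitionFn_mem_Icc hβ hs).2

lemma BoundedReturn.log_partitionFn_mem_Icc (hR : M.BoundedReturn R) (hβ : 0 < β) {s : S}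
    (hs : s ∈ M.init.support) :
    Real.log (M.partitionFn πref β H s).toReal ∈ Set.Icc 0 (R / β) := by
  obtain ⟨hge, hle⟩ := hR.partitionFn_mem_Icc (πref := πref) hβ hs
  have hge' := ENNReal.toReal_mono (hR.partitionFn_ne_top hβ hs) hge
  rw [ENNReal.toReal_one] at hge'
  refine ⟨Real.log_nonneg hge', (Real.log_le_iff_le_exp (by linarith)).2 ?_⟩
  exact ENNReal.toReal_le_of_le_ofReal (Real.exp_pos _).le hle

lemma BoundedReturn.polProb_gibbsPolicy_path_mul (hR : M.BoundedReturn R) (hβ : 0 < β)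
    (href : ∀ τ, M.Admissible τ → 0 < polProb πref τ) {s : S} (hs : s ∈ M.init.support)
    {as : List A} (has : as.length = H) :
    polProb (M.gibbsPolicy πref β) (M.path s as) * (M.partitionFn πref β H s).toReal =
      polProb πref (M.path s as) * Real.exp (M.ret (M.path s as) / β) := by
  have h := polProb_gibbsPolicy_mul (πref := πref) (β := β) as s
    (fun _ => by rw [M.layer_init s hs, zero_add, has])
    (by rw [has]; exact hR.partitionFn_ne_top hβ hs) (href _ ⟨s, hs, as, has, rfl⟩)
  rwa [has] at h

lemma BoundedReturn.polProb_gibbsPolicy_pos (hR : M.BoundedReturn R) (hβ : 0 < β)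
    (href : ∀ τ, M.Admissible τ → 0 < polProb πref τ) {τ : Traj S A} (hτ : M.Admissible τ) :
    0 < polProb (M.gibbsPolicy πref β) τ := by
  have hpos := href τ hτ
  obtain ⟨s, hs, as, has, rfl⟩ := hτ
  refine pos_of_mul_pos_left ?_ (ENNReal.toReal_nonneg (a := M.partitionFn πref β H s))
  rw [hR.polProb_gibbsPolicy_path_mul hβ href hs has]
  positivity

lemma BoundedReturn.klReward_gibbsPolicy (hR : M.BoundedReturn R) (hβ : 0 < β)
    (href : ∀ τ, M.Admissible τ → 0 < polProb πref τ) {s : S} (hs : s ∈ M.init.support)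
    {as : List A} (has : as.length = H) :
    M.klReward πref β (M.gibbsPolicy πref β) (M.path s as) =
      β * Real.log (M.partitionFn πref β H s).toReal := by
  have hτ : M.Admissible (M.path s as) := ⟨s, hs, as, has, rfl⟩
  have hZ := ENNReal.toReal_pos (partitionFn_ne_zero πref β H s) (hR.partitionFn_ne_top hβ hs)
  have hg := hR.polProb_gibbsPolicy_pos hβ href hτ
  have hlog := congrArg Real.log (hR.polProb_gibbsPolicy_path_mul hβ href hs has)
  rw [Real.log_mul hg.ne' hZ.ne', Real.log_mul (href _ hτ).ne' (Real.exp_pos _).ne',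
    Real.log_exp] at hlog
  rw [klReward, logRatio, Real.log_div hg.ne' (href _ hτ).ne',
    ← mul_div_cancel₀ (M.ret (M.path s as)) hβ.ne']
  linear_combination (-β) * hlog

lemma BoundedReturn.isCalibrated_gibbsPolicy (hR : M.BoundedReturn R) (hβ : 0 < β)
    (href : ∀ τ, M.Admissible τ → 0 < polProb πref τ) :
    M.IsCalibrated πref β (M.gibbsPolicy πref β) := by
  rintro _ ⟨s, hs, as, as', has, has', rfl⟩
  rw [discrepancy_eq_klReward_sub, hR.klReward_gibbsPolicy hβ href hs has,
    hR.klReward_gibbsPolicy hβ href hs has', sub_self]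

lemma BoundedReturn.bddTraj_klReward_gibbsPolicy (hR : M.BoundedReturn R) (hβ : 0 < β)
    (href : ∀ τ, M.Admissible τ → 0 < polProb πref τ) :
    M.BddTraj (M.klReward πref β (M.gibbsPolicy πref β)) := by
  refine ⟨R, ?_⟩
  rintro τ ⟨s, hs, as, has, rfl⟩
  obtain ⟨hnonneg, hle⟩ := hR.log_partitionFn_mem_Icc (πref := πref) hβ hs
  rw [hR.klReward_gibbsPolicy hβ href hs has, abs_of_nonneg (mul_nonneg hβ.le hnonneg)]
  exact (le_div_iff₀' hβ).1 hle

lemma eexpect_rollout_ratio_le_one (π π' : Policy S A) (n : ℕ) (s : S) :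
    eexpect (M.rollout π n s) (fun τ => ENNReal.ofReal (polProb π' τ / polProb π τ)) ≤
      1 := by
  induction n generalizing s with
  | zero => simp [rollout, polProb]
  | succ n ih =>
    rw [rollout, eexpect_bind]
    simp only [eexpect_map, polProb_cons, mul_div_mul_comm]
    calc _ ≤ eexpect (π s) fun a => ENNReal.ofReal ((π' s a).toReal / (π s a).toReal) := by
          refine eexpect_mono fun a _ => ?_
          simp only [ENNReal.ofReal_mul (div_nonneg ENNReal.toReal_nonneg ENNReal.toReal_nonneg),
            eexpect_const_mul]
          exact mul_le_of_le_one_right' (ih _)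
      _ ≤ ∑' a, π' s a := by
          refine ENNReal.tsum_le_tsum fun a => ?_
          by_cases h : π s a = 0
          · simp [h]
          · beta_reduce
            rw [ENNReal.ofReal_div_of_pos (ENNReal.toReal_pos h ((π s).apply_ne_top a)),
              ENNReal.ofReal_toReal ((π s).apply_ne_top a),
              ENNReal.ofReal_toReal ((π' s).apply_ne_top a)]
            exact ENNReal.mul_div_le
      _ = 1 := (π' s).tsum_coe

lemma eexpect_trajLaw_ratio_le_one (π π' : Policy S A) :
    eexpect (M.trajLaw (PMF.pure π)) (fun τ => ENNReal.ofReal (polProb π' τ / polProb π τ)) ≤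
      1 := by
  simp only [trajLaw, response, PMF.pure_bind, eexpect_bind]
  exact eexpect_le_const fun s _ => eexpect_rollout_ratio_le_one π π' H s

lemma exp_klReward_sub_div (hβ : β ≠ 0) {τ : Traj S A} (href : 0 < polProb πref τ)
    (hπ : 0 < polProb π τ) (hπ' : 0 < polProb π' τ) :
    Real.exp ((M.klReward πref β π τ - M.klReward πref β π' τ) / β) =
      polProb π' τ / polProb π τ := by
  rw [← Real.exp_log (div_pos hπ' hπ), Real.log_div hπ'.ne' hπ.ne', klReward, klReward, logRatio,
    logRatio, Real.log_div hπ.ne' href.ne', Real.log_div hπ'.ne' href.ne']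
  congr 1
  field_simp
  ring

lemma IsCalibrated.klReward_eq_of_J_le (hcal : M.IsCalibrated πref β π') (hβ : 0 < β)
    (hpos : ∀ τ, M.Admissible τ → 0 < polProb πref τ ∧ 0 < polProb π τ ∧ 0 < polProb π' τ)
    (hbdd : M.BddTraj (M.klReward πref β π)) (hbdd' : M.BddTraj (M.klReward πref β π'))
    (hJ : M.J πref β π' ≤ M.J πref β π) {τ : Traj S A} (hτ : M.Admissible τ) :
    M.klReward πref β π τ = M.klReward πref β π' τ := by
  set P := M.trajLaw (PMF.pure π)
  set u : Traj S A → ℝ := fun τ => β⁻¹ * (M.klReward πref β π τ - M.klReward πref β π' τ) with hu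
  have hexp : ∀ τ, M.Admissible τ → Real.exp (u τ) = polProb π' τ / polProb π τ := by
    intro τ hτ
    obtain ⟨href, hπ, hπ'⟩ := hpos τ hτ
    rw [← exp_klReward_sub_div hβ.ne' href hπ hπ', hu, div_eq_inv_mul]
  have hub : BddOn P u := ((hbdd.bddOn _).sub (hbdd'.bddOn _)).const_mul _
  have hmean : 0 ≤ expect P u := by
    rw [hu, expect_const_mul, expect_sub (hbdd.bddOn _) (hbdd'.bddOn _), hcal.expect_klReward hbdd']
    exact mul_nonneg (inv_nonneg.2 hβ.le) (sub_nonneg.2 hJ)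
  have hratio : expect P (fun τ => Real.exp (u τ)) ≤ 1 := by
    rw [← ENNReal.ofReal_le_one, ← eexpect_ofReal hub.exp fun τ _ => (Real.exp_pos _).le,
      eexpect_congr fun τ hτ => by rw [hexp τ (M.admissible_of_mem_support_trajLaw hτ)]]
    exact eexpect_trajLaw_ratio_le_one π π'
  have hzero : u τ = 0 := eq_zero_of_expect_exp_le_one hub hmean hratio τ
    (M.mem_support_trajLaw hτ (hpos τ hτ).2.1)
  simpa [hu, hβ.ne', sub_eq_zero] using hzero

theorem IsOptimal.isCalibrated (hopt : M.IsOptimal πref β πstar) (hβ : 0 < β)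
    (hR : M.BoundedReturn R) (hV : M.BoundedRatio πref Pol β V) (hstar : πstar ∈ Pol) :
    M.IsCalibrated πref β πstar := by
  have href : ∀ τ, M.Admissible τ → 0 < polProb πref τ := fun τ hτ => (hV πstar hstar τ hτ).1
  have hgibbs := hR.isCalibrated_gibbsPolicy hβ href
  have hbdd := hR.bddTraj_klReward_gibbsPolicy hβ href
  have heq : ∀ τ, M.Admissible τ →
      M.klReward πref β πstar τ = M.klReward πref β (M.gibbsPolicy πref β) τ := fun τ hτ =>
    hgibbs.klReward_eq_of_J_le hβ
      (fun τ hτ => ⟨href τ hτ, (hV πstar hstar τ hτ).2.1, hR.polProb_gibbsPolicy_pos hβ href hτ⟩)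
      (hR.bddTraj_klReward hV hβ hstar) hbdd (hopt.2 _ (hbdd.bddOn _).summable) hτ
  intro x hx
  rw [discrepancy_eq_klReward_sub, heq _ hx.fst, heq _ hx.snd, ← discrepancy_eq_klReward_sub]
  exact hgibbs x hx

end DCMDP

end Gibbs

/-! ### The logistic preference model -/

section Logistic

variable {x z : ℝ}

lemma sq_sub_le_four_mul_sq_sqrt_sub_sqrt {a b : ℝ} (ha : a ∈ Set.Icc 0 1)
    (hb : b ∈ Set.Icc 0 1) : (a - b) ^ 2 ≤ 4 * (√a - √b) ^ 2 := by
  have hfactor : a - b = (√a - √b) * (√a + √b) := by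
    rw [mul_comm, ← sq_sub_sq, Real.sq_sqrt ha.1, Real.sq_sqrt hb.1]
  have hsum : (√a + √b) ^ 2 ≤ 2 ^ 2 :=
    pow_le_pow_left₀ (by positivity)
      (by linarith [Real.sqrt_le_one.2 ha.2, Real.sqrt_le_one.2 hb.2]) 2
  rw [hfactor, mul_pow]
  nlinarith [sq_nonneg (√a - √b)]

lemma sqrt_mul_add_sqrt_mul_le {p q : ℝ} (hp : p ∈ Set.Icc 0 1) (hq : q ∈ Set.Icc 0 1) :
    √(p * q) + √((1 - p) * (1 - q)) ≤ 1 - (p - q) ^ 2 / 4 := by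
  have hp' : 1 - p ∈ Set.Icc (0 : ℝ) 1 := ⟨sub_nonneg.2 hp.2, sub_le_self 1 hp.1⟩
  have hq' : 1 - q ∈ Set.Icc (0 : ℝ) 1 := ⟨sub_nonneg.2 hq.2, sub_le_self 1 hq.1⟩
  rw [Real.sqrt_mul hp.1, Real.sqrt_mul hp'.1]
  nlinarith [sq_sub_le_four_mul_sq_sqrt_sub_sqrt hp hq,
    sq_sub_le_four_mul_sq_sqrt_sub_sqrt hp' hq', Real.sq_sqrt hp.1, Real.sq_sqrt hq.1,
    Real.sq_sqrt hp'.1, Real.sq_sqrt hq'.1]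

lemma exp_neg_abs_le_sigmoid_mul (z : ℝ) :
    Real.exp (-|z|) / 4 ≤ Real.sigmoid z * (1 - Real.sigmoid z) := by
  rw [← Real.sigmoid_neg, Real.sigmoid_def, Real.sigmoid_def, neg_neg, ← mul_inv, Real.exp_neg,
    ← one_div, ← one_div, div_div]
  refine one_div_le_one_div_of_le (by positivity) ?_
  have hle : Real.exp z ≤ Real.exp |z| := Real.exp_le_exp.2 (le_abs_self z)
  have hle' : Real.exp (-z) ≤ Real.exp |z| := Real.exp_le_exp.2 (neg_le_abs z)
  have hmul : Real.exp (-z) * Real.exp z = 1 := by rw [← Real.exp_add]; simp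
  linarith [Real.one_le_exp (abs_nonneg z)]

lemma sigmoid_sub_sigmoid (x z : ℝ) : Real.sigmoid x - Real.sigmoid z =
    Real.sigmoid x * (1 - Real.sigmoid z) * (1 - Real.exp (-(x - z))) := by
  have hexp : Real.exp (-(x - z)) * Real.exp (-z) = Real.exp (-x) := by
    rw [← Real.exp_add]; ring_nf
  have hpos : 1 + Real.exp (-(x - z)) * Real.exp (-z) ≠ 0 := by positivity
  have hpos' : 1 + Real.exp (-z) ≠ 0 := by positivity
  rw [Real.sigmoid_def, Real.sigmoid_def, ← hexp]
  field_simp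
  ring

lemma div_one_add_le_one_sub_exp_neg {u : ℝ} (hu : -1 < u) :
    u / (1 + u) ≤ 1 - Real.exp (-u) := by
  have hpos : 0 < 1 + u := by linarith
  have hexp : Real.exp (-u) ≤ (1 + u)⁻¹ := by
    rw [Real.exp_neg]
    exact inv_anti₀ hpos (by linarith [Real.add_one_le_exp u])
  have hsplit : u / (1 + u) = 1 - (1 + u)⁻¹ := by
    field_simp
    ring
  linarith

lemma exp_neg_abs_mul_le_sigmoid_sub_sigmoid (h : z ≤ x) :
    Real.exp (-|z|) / 4 * ((x - z) / (1 + (x - z))) ≤ Real.sigmoid x - Real.sigmoid z := by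
  have hu : 0 ≤ x - z := sub_nonneg.2 h
  have hz : 0 ≤ 1 - Real.sigmoid z := sub_nonneg.2 (Real.sigmoid_le_one z)
  have hx := Real.sigmoid_nonneg x
  rw [sigmoid_sub_sigmoid]
  exact mul_le_mul
    ((exp_neg_abs_le_sigmoid_mul z).trans (mul_le_mul_of_nonneg_right (Real.sigmoid_le h) hz))
    (div_one_add_le_one_sub_exp_neg (by linarith)) (div_nonneg hu (by linarith))
    (mul_nonneg hx hz)

lemma exp_neg_mul_le_abs_sigmoid_sub_sigmoid {R W : ℝ} (hz : |z| ≤ R) (hW : 1 ≤ W)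
    (hxz : |x - z| ≤ 2 * W) :
    Real.exp (-R) * |x - z| / (12 * W) ≤ |Real.sigmoid x - Real.sigmoid z| := by
  wlog h : z ≤ x generalizing x z
  · have hneg := this (x := -x) (z := -z) (by rwa [abs_neg])
      (by rwa [neg_sub_neg, abs_sub_comm]) (by linarith)
    rwa [neg_sub_neg, Real.sigmoid_neg, Real.sigmoid_neg, sub_sub_sub_cancel_left,
      abs_sub_comm z x, abs_sub_comm (Real.sigmoid z)] at hneg
  have hu := sub_nonneg.2 h
  rw [abs_of_nonneg hu] at hxz ⊢
  calc Real.exp (-R) * (x - z) / (12 * W) = Real.exp (-R) / 4 * ((x - z) / (3 * W)) := by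
        field_simp
        ring
    _ ≤ Real.exp (-|z|) / 4 * ((x - z) / (1 + (x - z))) := by
        gcongr
        linarith
    _ ≤ |Real.sigmoid x - Real.sigmoid z| :=
        (exp_neg_abs_mul_le_sigmoid_sub_sigmoid h).trans (le_abs_self _)

lemma sqrt_sigmoid_mul_add_le {R W : ℝ} (hz : |z| ≤ R) (hW : 1 ≤ W) (hxz : |x - z| ≤ 2 * W) :
    √(Real.sigmoid x * Real.sigmoid z) + √(Real.sigmoid (-x) * Real.sigmoid (-z)) ≤
      1 - (x - z) ^ 2 / (576 * W ^ 2 * Real.exp (2 * R)) := by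
  rw [Real.sigmoid_neg, Real.sigmoid_neg]
  refine (sqrt_mul_add_sqrt_mul_le ⟨Real.sigmoid_nonneg x, Real.sigmoid_le_one x⟩
    ⟨Real.sigmoid_nonneg z, Real.sigmoid_le_one z⟩).trans (sub_le_sub_left ?_ 1)
  calc (x - z) ^ 2 / (576 * W ^ 2 * Real.exp (2 * R))
      = (Real.exp (-R) * |x - z| / (12 * W)) ^ 2 / 4 := by
        rw [div_pow, mul_pow, sq_abs, Real.exp_neg, two_mul R, Real.exp_add]
        field_simp
        ring
    _ ≤ |Real.sigmoid x - Real.sigmoid z| ^ 2 / 4 := by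
        gcongr
        exact exp_neg_mul_le_abs_sigmoid_sub_sigmoid hz hW hxz
    _ = (Real.sigmoid x - Real.sigmoid z) ^ 2 / 4 := by rw [sq_abs]

lemma mul_exp_half_log_sub {a b : ℝ} (ha : 0 < a) (hb : 0 < b) :
    b * Real.exp ((Real.log a - Real.log b) / 2) = √(a * b) := by
  rw [← Real.log_div ha.ne' hb.ne', Real.exp_half, Real.exp_log (div_pos ha hb),
    Real.sqrt_div ha.le, Real.sqrt_mul ha.le]
  nth_rewrite 1 [← Real.mul_self_sqrt hb.le]
  field_simp [(Real.sqrt_pos.2 hb).ne']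

lemma exp_div_exp_add_exp (a b : ℝ) :
    Real.exp a / (Real.exp a + Real.exp b) = Real.sigmoid (a - b) := by
  rw [Real.sigmoid_def, neg_sub, Real.exp_sub]
  field_simp

end Logistic

section Likelihood

variable {S A : Type*} {H : ℕ}

/-- The log-likelihood of a comparison `(τ₊, τ₋)` under the preference model induced by `π`. -/
def logLik (πref : Policy S A) (β : ℝ) (π : Policy S A) (x : Traj S A × Traj S A) : ℝ :=
  Real.log (Real.sigmoid (β * logRatio π πref x.1 - β * logRatio π πref x.2))

/-- The comparison `(τ₊, τ₋)` obtained from two responses and the label `τ ≻ τ̃`. -/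
def labelled (x : Traj S A × Traj S A) (y : Bool) : Traj S A × Traj S A :=
  if y then (x.1, x.2) else (x.2, x.1)

/-- The factor by which the squared Hellinger distance between preference models may be smaller than
the squared discrepancy. The slope of the sigmoid on the relevant range is at least
`e^{-R} / (12 (V + R))`, and `576 = 4 * 12²`. -/
def infoConst (V R : ℝ) : ℝ := 576 * (V + R) ^ 2 * Real.exp (2 * R)

lemma infoConst_pos {V R : ℝ} (hW : 0 < V + R) : 0 < infoConst V R := by
  unfold infoConst
  positivity

lemma sq_le_infoConst {V R : ℝ} (hR : 0 ≤ R) : 576 * (V + R) ^ 2 ≤ infoConst V R :=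
  le_mul_of_one_le_right (by positivity) (Real.one_le_exp (by positivity))

namespace DCMDP

/-- The law of the comparison `(τ₊, τ₋)` of responses of `π` and `π̃`. -/
def comparisonLaw (M : DCMDP S A H) (π : Policy S A) (ν : MixedPolicy S A) :
    PMF (Traj S A × Traj S A) :=
  (M.pairLaw π ν).bind fun x => (M.preference x.1 x.2).map (labelled x)

variable {M : DCMDP S A H} {πref π πstar : Policy S A} {β V R : ℝ} {Pol : Finset (Policy S A)}

lemma preference_apply (τ τ' : Traj S A) (y : Bool) :
    M.preference τ τ' y = ENNReal.ofReal (Real.sigmoid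
      (M.ret (labelled (τ, τ') y).1 - M.ret (labelled (τ, τ') y).2)) := by
  rw [preference, PMF.ofFintype_apply]
  cases y
  · rw [add_comm, labelled, ← exp_div_exp_add_exp]
    rfl
  · rw [labelled, ← exp_div_exp_add_exp]
    rfl

lemma expMoment_preference_le (hR : M.BoundedReturn R) (hV : M.BoundedRatio πref Pol β V)
    (hβ : 0 < β) (hW : 1 ≤ V + R) (hcal : M.IsCalibrated πref β πstar) (hπ : π ∈ Pol)
    {x : Traj S A × Traj S A} (hx : M.AdmissiblePair x) :
    expMoment (M.preference x.1 x.2)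
      (fun y => (logLik πref β π (labelled x y) - logLik πref β πstar (labelled x y)) / 2) ≤
      ENNReal.ofReal (1 - M.discrepancy πref β π x ^ 2 / infoConst V R) := by
  set u := β * logRatio π πref x.1 - β * logRatio π πref x.2 with hu
  set z := M.ret x.1 - M.ret x.2 with hz
  have hu' : β * logRatio π πref x.2 - β * logRatio π πref x.1 = -u := by rw [hu]; ring
  have hz' : M.ret x.2 - M.ret x.1 = -z := by rw [hz]; ring
  have hdisc : M.discrepancy πref β π x = u - z := by rw [discrepancy, hu, hz]; ring
  have hstar : β * logRatio πstar πref x.1 - β * logRatio πstar πref x.2 = z := by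
    linarith [(discrepancy.eq_1 M πref β πstar x).symm.trans (hcal x hx)]
  have hstar' : β * logRatio πstar πref x.2 - β * logRatio πstar πref x.1 = -z := by
    rw [← hstar]; ring
  have hzR : |z| ≤ R := by
    obtain ⟨hnonneg, hle⟩ := hR _ hx.fst
    obtain ⟨hnonneg', hle'⟩ := hR _ hx.snd
    rw [hz, abs_le]
    constructor <;> linarith
  have huz : |u - z| ≤ 2 * (V + R) := hdisc ▸ hR.abs_discrepancy_le hV hβ hπ hx
  rw [expMoment, eexpect, tsum_fintype, Fintype.sum_bool, preference_apply, preference_apply]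
  simp only [labelled, logLik, if_true, Bool.false_eq_true, if_false]
  rw [← hu, hstar, ← hz, hu', hstar', hz', ← ENNReal.ofReal_mul (Real.sigmoid_nonneg _),
    ← ENNReal.ofReal_mul (Real.sigmoid_nonneg _), mul_exp_half_log_sub (Real.sigmoid_pos _)
    (Real.sigmoid_pos _), mul_exp_half_log_sub (Real.sigmoid_pos _) (Real.sigmoid_pos _),
    ← ENNReal.ofReal_add (Real.sqrt_nonneg _) (Real.sqrt_nonneg _), hdisc]
  exact ENNReal.ofReal_le_ofReal (sqrt_sigmoid_mul_add_le hzR hW huz)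

lemma BoundedReturn.sq_discrepancy_le (hR : M.BoundedReturn R) (hV : M.BoundedRatio πref Pol β V)
    (hβ : 0 < β) (hπ : π ∈ Pol) {x : Traj S A × Traj S A} (hx : M.AdmissiblePair x) :
    M.discrepancy πref β π x ^ 2 ≤ 4 * (V + R) ^ 2 := by
  rw [← sq_abs]
  exact (pow_le_pow_left₀ (abs_nonneg _) (hR.abs_discrepancy_le hV hβ hπ hx) 2).trans_eq (by ring)

lemma BoundedReturn.bddOn_discrepancy (hR : M.BoundedReturn R) (hV : M.BoundedRatio πref Pol β V)
    (hβ : 0 < β) (hπ : π ∈ Pol) (q : Policy S A) (ν : MixedPolicy S A) :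
    BddOn (M.pairLaw q ν) (M.discrepancy πref β π) :=
  ⟨_, fun _ hx => hR.abs_discrepancy_le hV hβ hπ (M.admissiblePair_of_mem_support_pairLaw hx)⟩

lemma BoundedReturn.expect_sq_discrepancy_le (hR : M.BoundedReturn R)
    (hV : M.BoundedRatio πref Pol β V) (hβ : 0 < β) (hπ : π ∈ Pol) (q : Policy S A)
    (ν : MixedPolicy S A) :
    expect (M.pairLaw q ν) (fun x => M.discrepancy πref β π x ^ 2) ≤ 4 * (V + R) ^ 2 :=
  expect_le_const (hR.bddOn_discrepancy hV hβ hπ q ν).sq fun _ hx =>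
    hR.sq_discrepancy_le hV hβ hπ (M.admissiblePair_of_mem_support_pairLaw hx)

lemma BoundedReturn.sq_discrepancy_le_infoConst (hR : M.BoundedReturn R)
    (hV : M.BoundedRatio πref Pol β V) (hβ : 0 < β) (hπ : π ∈ Pol)
    {x : Traj S A × Traj S A} (hx : M.AdmissiblePair x) :
    M.discrepancy πref β π x ^ 2 ≤ infoConst V R := by
  have hR0 : 0 ≤ R := (abs_nonneg _).trans (hR.abs_ret_le hx.fst)
  calc M.discrepancy πref β π x ^ 2 ≤ 4 * (V + R) ^ 2 := hR.sq_discrepancy_le hV hβ hπ hx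
    _ ≤ 576 * (V + R) ^ 2 := by linarith [sq_nonneg (V + R)]
    _ ≤ infoConst V R := sq_le_infoConst hR0

lemma expMoment_comparisonLaw_le (hR : M.BoundedReturn R) (hV : M.BoundedRatio πref Pol β V)
    (hβ : 0 < β) (hW : 1 ≤ V + R) (hcal : M.IsCalibrated πref β πstar) (hπ : π ∈ Pol)
    (q : Policy S A) (ν : MixedPolicy S A) :
    expMoment (M.comparisonLaw q ν) (fun x => (logLik πref β π x - logLik πref β πstar x) / 2) ≤
      ENNReal.ofReal (Real.exp
        (-(expect (M.pairLaw q ν) (fun x => M.discrepancy πref β π x ^ 2) / infoConst V R))) := by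
  set d : Traj S A × Traj S A → ℝ := fun x => M.discrepancy πref β π x ^ 2
  set K := infoConst V R
  have hd : BddOn (M.pairLaw q ν) fun x => K⁻¹ * d x :=
    ((hR.bddOn_discrepancy hV hβ hπ q ν).sq).const_mul _
  calc expMoment (M.comparisonLaw q ν) (fun x => (logLik πref β π x - logLik πref β πstar x) / 2)
      ≤ eexpect (M.pairLaw q ν) fun x => ENNReal.ofReal (1 - K⁻¹ * d x) := by
        rw [expMoment, comparisonLaw, eexpect_bind]
        refine eexpect_mono fun x hx => ?_
        rw [← div_eq_inv_mul]
        exact (expMoment_map _ _ _).trans_le (expMoment_preference_le hR hV hβ hW hcal hπ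
          (M.admissiblePair_of_mem_support_pairLaw hx))
    _ = ENNReal.ofReal (1 - expect (M.pairLaw q ν) d / K) := by
        rw [eexpect_ofReal ((BddOn.const _ 1).sub hd), expect_sub (BddOn.const _ 1) hd,
          expect_const, expect_const_mul, div_eq_inv_mul]
        intro x hx
        rw [sub_nonneg, ← div_eq_inv_mul, div_le_one (infoConst_pos (by linarith))]
        exact hR.sq_discrepancy_le_infoConst hV hβ hπ (M.admissiblePair_of_mem_support_pairLaw hx)
    _ ≤ ENNReal.ofReal (Real.exp (-(expect (M.pairLaw q ν) d / K))) :=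
        ENNReal.ofReal_le_ofReal <| by
          linarith [Real.add_one_le_exp (-(expect (M.pairLaw q ν) d / K))]

end DCMDP

end Likelihood

/-! ### The run of the algorithm -/

section Algorithm

variable {S A : Type*} {H : ℕ}

/-- The sampling policy `π̃ₙ` when the policies chosen so far are `p 0, …, p (n - 1)`. Unlike in
`DCMDP.tilde`, the first sampling policy is `π_ref`, as in the algorithm. -/
def sampSeq (πref : Policy S A) (samp : Strategy S A) (p : ℕ → Policy S A) (n : ℕ) :
    MixedPolicy S A :=
  if n ≤ 1 then PMF.pure πref else samp ((List.range n).map p)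

lemma sampSeq_refStrategy (πref : Policy S A) (p : ℕ → Policy S A) (n : ℕ) :
    sampSeq πref (refStrategy πref) p n = PMF.pure πref :=
  ite_self _

/-- The in-sample error: the cumulative expected squared discrepancy of `π` over the first `n`
iterations. -/
def cumSq (M : DCMDP S A H) (πref : Policy S A) (β : ℝ) (samp : Strategy S A) (p : ℕ → Policy S A)
    (n : ℕ) (π : Policy S A) : ℝ :=
  ∑ i ∈ Finset.range n, expect (M.pairLaw (p i) (sampSeq πref samp p (i + 1)))
    fun x => M.discrepancy πref β π x ^ 2

lemma sampSeq_congr (πref : Policy S A) (samp : Strategy S A) {p p' : ℕ → Policy S A} {n : ℕ}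
    (h : ∀ i < n, p i = p' i) : sampSeq πref samp p n = sampSeq πref samp p' n := by
  rw [sampSeq, sampSeq, List.map_congr_left fun i hi => h i (List.mem_range.1 hi)]

lemma cumSq_congr (M : DCMDP S A H) (πref : Policy S A) (β : ℝ) (samp : Strategy S A)
    {p p' : ℕ → Policy S A} {n : ℕ} (h : ∀ i < n, p i = p' i) (π : Policy S A) :
    cumSq M πref β samp p n π = cumSq M πref β samp p' n π := by
  refine Finset.sum_congr rfl fun i hi => ?_
  have hi' := Finset.mem_range.1 hi
  rw [h i hi', sampSeq_congr πref samp fun j hj => h j (by lia)]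

/-- What one iteration observes: the two responses, the label `τ ≻ τ̃`, and the optimism data. -/
structure Feedback (S A : Type*) where
  responses : Traj S A × Traj S A
  label : Bool
  opt : List (Traj S A)

/-- The labelled pair `(τ₊, τ₋)`. -/
def Feedback.comparison (w : Feedback S A) : Traj S A × Traj S A := labelled w.responses w.label

namespace State

/-- The chosen policies `π₁, π₂, …` as a sequence indexed from `0`, continued by the default value
`d` beyond the current iteration. -/
def seq (d : Policy S A) (st : State S A) (i : ℕ) : Policy S A := st.policies.getD i d

/-- The deterministic part of an iteration: the state after the feedback `w`. -/
def advance (samp : Strategy S A) (sel : Selector S A) (st : State S A) (w : Feedback S A) :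
    State S A where
  past := st.policies
  cur := sel st (st.prefs ++ [w.comparison]) w.opt
  sampler := samp (st.policies ++ [sel st (st.prefs ++ [w.comparison]) w.opt])
  prefs := st.prefs ++ [w.comparison]
  seconds := st.seconds ++ [w.responses.2]

variable {samp : Strategy S A} {sel : Selector S A} {d : Policy S A} {st : State S A}
  {w : Feedback S A}

lemma length_policies (st : State S A) : st.policies.length = st.past.length + 1 := by
  simp [policies]

lemma past_length_advance : (st.advance samp sel w).past.length = st.past.length + 1 :=
  st.length_policies

lemma seq_advance_of_le {i : ℕ} (hi : i ≤ st.past.length) :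
    (st.advance samp sel w).seq d i = st.seq d i :=
  List.getD_append _ _ _ _ (st.length_policies ▸ Nat.lt_succ_of_le hi)

lemma seq_past_length : st.seq d st.past.length = st.cur := by
  simp [seq, policies]

lemma seq_advance_succ : (st.advance samp sel w).seq d (st.past.length + 1) =
    sel st (st.prefs ++ [w.comparison]) w.opt := by
  rw [← past_length_advance, seq_past_length, advance]

lemma seq_of_lt {i : ℕ} (hi : st.past.length < i) : st.seq d i = d :=
  List.getD_eq_default _ _ (st.length_policies ▸ hi)

lemma policies_eq_map_seq : st.policies = (List.range (st.past.length + 1)).map (st.seq d) := by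
  refine List.ext_getElem (by simp [length_policies]) fun i hi _ => ?_
  simp [seq, List.getElem?_eq_getElem hi]

lemma seq_mem_policies {i : ℕ} (hi : i ≤ st.past.length) : st.seq d i ∈ st.policies := by
  rw [policies_eq_map_seq (d := d)]
  exact List.mem_map_of_mem (List.mem_range.2 (Nat.lt_succ_of_le hi))

end State

/-- The law of the feedback of an iteration started in state `st`. -/
def feedbackLaw (M : DCMDP S A H)
    (draw : MixedPolicy S A → List (Traj S A) → PMF (List (Traj S A))) (st : State S A) :
    PMF (Feedback S A) :=
  (M.pairLaw st.cur st.sampler).bind fun x => (M.preference x.1 x.2).bind fun y =>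
    (draw st.sampler (st.seconds ++ [x.2])).map fun opt => ⟨x, y, opt⟩

/-- The joint law of the state and the feedback in iteration `n`, counted from `0`. -/
def iterationLaw (M : DCMDP S A H) (πref : Policy S A) (samp : Strategy S A) (sel : Selector S A)
    (draw : MixedPolicy S A → List (Traj S A) → PMF (List (Traj S A))) (n : ℕ) :
    PMF (State S A × Feedback S A) :=
  (run M πref samp sel draw n).bind fun st => (feedbackLaw M draw st).map (Prod.mk st)

section Law

variable (M : DCMDP S A H) (πref : Policy S A) (samp : Strategy S A) (sel : Selector S A)
  (draw : MixedPolicy S A → List (Traj S A) → PMF (List (Traj S A)))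

lemma step_eq_map_feedbackLaw (st : State S A) :
    step M samp sel draw st = (feedbackLaw M draw st).map (st.advance samp sel) := by
  simp only [step, feedbackLaw, DCMDP.pairLaw, PMF.bind_bind, PMF.bind_map, PMF.map_bind,
    PMF.map_comp, Function.comp_def]
  rfl

lemma run_succ_eq_map_iterationLaw (n : ℕ) : run M πref samp sel draw (n + 1) =
    (iterationLaw M πref samp sel draw n).map fun z => z.1.advance samp sel z.2 := by
  rw [run, iterationLaw, PMF.map_bind]
  congr 1 with st : 1
  rw [step_eq_map_feedbackLaw, PMF.map_comp]
  rfl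

lemma iterationLaw_map_fst (n : ℕ) :
    (iterationLaw M πref samp sel draw n).map Prod.fst = run M πref samp sel draw n := by
  have hconst : ∀ st : State S A,
      (Prod.fst ∘ Prod.mk st : Feedback S A → State S A) = Function.const _ st := fun _ => rfl
  simp only [iterationLaw, PMF.map_bind, PMF.map_comp, hconst, PMF.map_const, PMF.bind_pure]

lemma feedbackLaw_map_comparison (st : State S A) :
    (feedbackLaw M draw st).map Feedback.comparison = M.comparisonLaw st.cur st.sampler := by
  have hconst : ∀ (x : Traj S A × Traj S A) (y : Bool),
      (Feedback.comparison ∘ fun opt => ⟨x, y, opt⟩) = Function.const _ (labelled x y) :=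
    fun _ _ => rfl
  simp only [feedbackLaw, DCMDP.comparisonLaw, PMF.map_bind, PMF.map_comp, hconst, PMF.map_const]
  rfl

lemma feedbackLaw_map_responses (st : State S A) :
    (feedbackLaw M draw st).map Feedback.responses = M.pairLaw st.cur st.sampler := by
  have hconst : ∀ (x : Traj S A × Traj S A) (y : Bool),
      (Feedback.responses ∘ fun opt => ⟨x, y, opt⟩) = Function.const _ x :=
    fun _ _ => rfl
  simp only [feedbackLaw, PMF.map_bind, PMF.map_comp, hconst, PMF.map_const, PMF.bind_const,
    PMF.bind_pure]

variable {M πref samp sel draw}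

lemma mem_support_feedbackLaw {st : State S A} {w : Feedback S A}
    (hw : w ∈ (feedbackLaw M draw st).support) : M.AdmissiblePair w.responses ∧
      w.opt ∈ (draw st.sampler (st.seconds ++ [w.responses.2])).support := by
  simp only [feedbackLaw, PMF.mem_support_bind_iff, PMF.mem_support_map_iff] at hw
  obtain ⟨x, hx, y, -, opt, hopt, rfl⟩ := hw
  exact ⟨M.admissiblePair_of_mem_support_pairLaw hx, hopt⟩

lemma mem_support_iterationLaw {n : ℕ} {z : State S A × Feedback S A}
    (hz : z ∈ (iterationLaw M πref samp sel draw n).support) :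
    z.1 ∈ (run M πref samp sel draw n).support ∧ z.2 ∈ (feedbackLaw M draw z.1).support := by
  simp only [iterationLaw, PMF.mem_support_bind_iff, PMF.mem_support_map_iff] at hz
  obtain ⟨st, hst, w, hw, rfl⟩ := hz
  exact ⟨hst, hw⟩

end Law

/-- Properties of every state reached after `n` iterations; `d` is the default policy of
`State.seq`. -/
structure Reached (M : DCMDP S A H) (πref : Policy S A) (Pol : Finset (Policy S A))
    (samp : Strategy S A) (d : Policy S A) (n : ℕ) (st : State S A) : Prop where
  past_length : st.past.length = n
  seconds_length : st.seconds.length = n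
  sampler : st.sampler = sampSeq πref samp (st.seq d) (n + 1)
  seq_zero : st.seq d 0 = πref
  seq_mem : ∀ i, 1 ≤ i → st.seq d i ∈ Pol
  seconds : ∀ τ ∈ st.seconds, M.Admissible τ

variable {M : DCMDP S A H} {πref d : Policy S A} {Pol : Finset (Policy S A)} {samp : Strategy S A}
  {sel : Selector S A} {draw : MixedPolicy S A → List (Traj S A) → PMF (List (Traj S A))}
  {st : State S A} {w : Feedback S A} {n : ℕ}

namespace Reached

lemma admissible_seconds_concat (h : Reached M πref Pol samp d n st)
    (hw : M.AdmissiblePair w.responses) : ∀ τ ∈ st.seconds ++ [w.responses.2], M.Admissible τ := by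
  simp only [List.mem_append, List.mem_singleton]
  rintro τ (hτ | rfl)
  exacts [h.seconds τ hτ, hw.snd]

lemma sampSeq_advance (h : Reached M πref Pol samp d n st) :
    sampSeq πref samp ((st.advance samp sel w).seq d) (n + 1) = st.sampler := by
  rw [h.sampler]
  exact sampSeq_congr πref samp fun i hi =>
    State.seq_advance_of_le (h.past_length ▸ Nat.le_of_lt_succ hi)

lemma advance (h : Reached M πref Pol samp d n st) (hd : d ∈ Pol)
    (hsel : ∀ st prefs opt, sel st prefs opt ∈ Pol) (hw : M.AdmissiblePair w.responses) :
    Reached M πref Pol samp d (n + 1) (st.advance samp sel w) where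
  past_length := by rw [State.past_length_advance, h.past_length]
  seconds_length := by simp [State.advance, h.seconds_length]
  sampler := by
    rw [sampSeq, if_neg (by lia), ← h.past_length, ← State.past_length_advance,
      ← State.policies_eq_map_seq]
    rfl
  seq_zero := by rw [State.seq_advance_of_le (Nat.zero_le _), h.seq_zero]
  seq_mem i hi := by
    rcases lt_trichotomy i (st.past.length + 1) with hlt | rfl | hgt
    · rw [State.seq_advance_of_le (Nat.le_of_lt_succ hlt)]
      exact h.seq_mem i hi
    · rw [State.seq_advance_succ]
      exact hsel _ _ _
    · rwa [State.seq_of_lt (State.past_length_advance.trans_lt hgt)]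
  seconds := h.admissible_seconds_concat hw

end Reached

lemma reached_of_mem_support_run (hd : d ∈ Pol) (hsel : ∀ st prefs opt, sel st prefs opt ∈ Pol)
    (hst : st ∈ (run M πref samp sel draw n).support) : Reached M πref Pol samp d n st := by
  induction n generalizing st with
  | zero =>
    obtain rfl := (PMF.mem_support_pure_iff _ _).1 hst
    refine ⟨rfl, rfl, rfl, rfl, fun i hi => ?_, by simp⟩
    rwa [State.seq_of_lt (Nat.lt_of_succ_le hi)]
  | succ n ih =>
    rw [run_succ_eq_map_iterationLaw, PMF.mem_support_map_iff] at hst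
    obtain ⟨z, hz, rfl⟩ := hst
    obtain ⟨hrun, hw⟩ := mem_support_iterationLaw hz
    exact (ih hrun).advance hd hsel (mem_support_feedbackLaw hw).1

end Algorithm

/-! ### Concentration along the run -/

section Concentration

variable {S A : Type*} {H : ℕ}

/-- The standing assumptions of the regret analysis: bounded returns and density ratios, and a
calibrated comparator `πstar` in the policy class. -/
structure Realizable (M : DCMDP S A H) (πref : Policy S A) (Pol : Finset (Policy S A))
    (β V R : ℝ) (πstar : Policy S A) : Prop where
  beta_pos : 0 < β
  one_le : 1 ≤ V + R
  ret : M.BoundedReturn R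
  ratio : M.BoundedRatio πref Pol β V
  mem : πstar ∈ Pol
  calibrated : M.IsCalibrated πref β πstar

variable {M : DCMDP S A H} {πref : Policy S A} {Pol : Finset (Policy S A)} {samp : Strategy S A}
  {sel : Selector S A} {draw : MixedPolicy S A → List (Traj S A) → PMF (List (Traj S A))}
  {β α V R ℓ : ℝ} {πstar π : Policy S A} {n : ℕ} {st : State S A} {w : Feedback S A}

namespace Realizable

lemma pos (hr : Realizable M πref Pol β V R πstar) : 0 < V + R := one_pos.trans_le hr.one_le

lemma R_nonneg (hr : Realizable M πref Pol β V R πstar) : 0 ≤ R := by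
  obtain ⟨τ, hτ⟩ := M.exists_admissible πstar
  exact (abs_nonneg _).trans (hr.ret.abs_ret_le hτ)

lemma V_nonneg (hr : Realizable M πref Pol β V R πstar) : 0 ≤ V :=
  hr.ratio.nonneg hr.beta_pos hr.mem

lemma abs_ratioGap_le (hr : Realizable M πref Pol β V R πstar) (hπ : π ∈ Pol) {τ : Traj S A}
    (hτ : M.Admissible τ) : |DCMDP.ratioGap πref β π πstar τ| ≤ 2 * (V + R) :=
  (hr.ratio.abs_ratioGap_le hr.beta_pos hπ hr.mem hτ).trans (by linarith [hr.R_nonneg])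

lemma J_sub_J_eq (hr : Realizable M πref Pol β V R πstar) (hπ : π ∈ Pol) (ν : MixedPolicy S A) :
    M.J πref β πstar - M.J πref β π = expect (M.pairLaw π ν) (M.discrepancy πref β π) +
      expect (M.trajLaw ν) (DCMDP.ratioGap πref β π πstar) :=
  hr.calibrated.J_sub_J_eq (hr.ret.bddTraj_klReward hr.ratio hr.beta_pos hr.mem)
    (hr.ret.bddTraj_klReward hr.ratio hr.beta_pos hπ) ν

lemma sum_ratioGap (hr : Realizable M πref Pol β V R πstar) (hπ : π ∈ Pol)
    {opt : List (Traj S A)} (hopt : ∀ τ ∈ opt, M.Admissible τ) :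
    (opt.map (DCMDP.ratioGap πref β π πstar)).sum =
      β * ((opt.map fun τ => Real.log (polProb π τ)).sum -
        (opt.map fun τ => Real.log (polProb πstar τ)).sum) := by
  induction opt with
  | nil => simp
  | cons τ opt ih =>
    simp only [List.map_cons, List.sum_cons]
    rw [ih fun τ' hτ' => hopt τ' (List.mem_cons_of_mem τ hτ'), DCMDP.ratioGap,
      add_sub_add_comm, mul_add, hr.ratio.log_polProb_sub hπ hr.mem (hopt τ List.mem_cons_self),
      mul_sub, mul_sub]

end Realizable

/-- The exponent of the supermartingale that bounds the in-sample error of `π` by its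
log-likelihood ratio to `πstar` on the preference data. -/
def likelihoodExponent (M : DCMDP S A H) (πref : Policy S A) (β V R : ℝ) (samp : Strategy S A)
    (πstar π : Policy S A) (st : State S A) : ℝ :=
  ((st.prefs.map (logLik πref β π)).sum - (st.prefs.map (logLik πref β πstar)).sum) / 2 +
    cumSq M πref β samp (st.seq πstar) st.past.length π / infoConst V R

lemma Reached.likelihoodExponent_advance (h : Reached M πref Pol samp πstar n st) :
    likelihoodExponent M πref β V R samp πstar π (st.advance samp sel w) =
      likelihoodExponent M πref β V R samp πstar π st +
          expect (M.pairLaw st.cur st.sampler) (fun x => M.discrepancy πref β π x ^ 2) /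
            infoConst V R +
        (logLik πref β π w.comparison - logLik πref β πstar w.comparison) / 2 := by
  have hcum : cumSq M πref β samp ((st.advance samp sel w).seq πstar)
      (st.advance samp sel w).past.length π =
        cumSq M πref β samp (st.seq πstar) st.past.length π +
          expect (M.pairLaw st.cur st.sampler) (fun x => M.discrepancy πref β π x ^ 2) := by
    rw [State.past_length_advance, cumSq_congr M πref β samp (p' := st.seq πstar) fun i hi =>
      State.seq_advance_of_le (Nat.le_of_lt_succ hi), cumSq, Finset.sum_range_succ, ← cumSq,
      State.seq_past_length, h.past_length, h.sampler]
  have hprefs : (st.advance samp sel w).prefs = st.prefs ++ [w.comparison] := rfl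
  simp only [likelihoodExponent, hcum, hprefs, List.map_append, List.sum_append,
    List.map_singleton, List.sum_singleton]
  ring

lemma expMoment_likelihoodExponent_le_one (hr : Realizable M πref Pol β V R πstar)
    (hsel : ∀ st prefs opt, sel st prefs opt ∈ Pol) (hπ : π ∈ Pol) (n : ℕ) :
    expMoment (run M πref samp sel draw n)
      (likelihoodExponent M πref β V R samp πstar π) ≤ 1 := by
  induction n with
  | zero => simp [run, likelihoodExponent, cumSq]
  | succ n ih =>
    refine (expMoment_bind_le fun st hst => ?_).trans ih
    have h := reached_of_mem_support_run hr.mem hsel hst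
    have hcomparison := DCMDP.expMoment_comparisonLaw_le hr.ret hr.ratio hr.beta_pos hr.one_le
      hr.calibrated hπ st.cur st.sampler
    rw [← feedbackLaw_map_comparison M draw st, expMoment_map] at hcomparison
    rw [step_eq_map_feedbackLaw, expMoment_map]
    simp only [h.likelihoodExponent_advance, expMoment_const_add]
    refine (mul_le_mul_right hcomparison _).trans_eq ?_
    rw [← ENNReal.ofReal_mul (Real.exp_pos _).le, ← Real.exp_add, add_neg_cancel_right]

/-- The optimism data consists of one admissible trajectory per iteration, and its empirical means
concentrate around the means under the current sampling policy. -/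
structure Concentrates (M : DCMDP S A H) (πref : Policy S A) (Pol : Finset (Policy S A))
    (β V R : ℝ) (πstar : Policy S A) (samp : Strategy S A) (sel : Selector S A)
    (draw : MixedPolicy S A → List (Traj S A) → PMF (List (Traj S A))) : Prop where
  admissible : ∀ ν l, (∀ τ ∈ l, M.Admissible τ) → ∀ opt ∈ (draw ν l).support,
    opt.length = l.length ∧ ∀ τ ∈ opt, M.Admissible τ
  deviation : ∀ n, ∀ π ∈ Pol, ∀ l, expMoment (iterationLaw M πref samp sel draw n) (fun z =>
    hoeffdingExponent (M.trajLaw z.1.sampler) (DCMDP.ratioGap πref β π πstar) (2 * (V + R)) l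
      z.2.opt) ≤ 1

lemma concentrates_iid (hr : Realizable M πref Pol β V R πstar) :
    Concentrates M πref Pol β V R πstar samp sel
      (fun ν seconds => iid (M.trajLaw ν) seconds.length) where
  admissible ν l _ opt hopt := by
    obtain ⟨hlen, hsupp⟩ := mem_support_iid hopt
    exact ⟨hlen, fun τ hτ => M.admissible_of_mem_support_trajLaw (hsupp τ hτ)⟩
  deviation n π hπ l := by
    refine expMoment_bind_le_one fun st _ => ?_
    rw [expMoment_map, feedbackLaw]
    refine expMoment_bind_le_one fun x _ => expMoment_bind_le_one fun y _ => ?_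
    rw [expMoment_map]
    exact expMoment_iid_hoeffdingExponent_le_one
      (fun τ hτ => hr.abs_ratioGap_le hπ (M.admissible_of_mem_support_trajLaw hτ)) l _

lemma sampler_eq_pure_of_mem_support_run
    (hst : st ∈ (run M πref (refStrategy πref) sel draw n).support) :
    st.sampler = PMF.pure πref := by
  cases n with
  | zero =>
    obtain rfl := (PMF.mem_support_pure_iff _ _).1 hst
    rfl
  | succ n =>
    rw [run_succ_eq_map_iterationLaw, PMF.mem_support_map_iff] at hst
    obtain ⟨z, -, rfl⟩ := hst
    rfl

section Seconds

variable {f : Traj S A → ℝ} {B : ℝ}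

lemma expMoment_hoeffdingExponent_seconds_concat_le (hB : ∀ τ, M.Admissible τ → |f τ| ≤ B)
    (l : ℝ) (n : ℕ) :
    expMoment (iterationLaw M πref (refStrategy πref) sel draw n) (fun z =>
        hoeffdingExponent (M.trajLaw (PMF.pure πref)) f B l (z.1.seconds ++ [z.2.responses.2])) ≤
      expMoment (run M πref (refStrategy πref) sel draw n) fun st =>
        hoeffdingExponent (M.trajLaw (PMF.pure πref)) f B l st.seconds := by
  refine expMoment_bind_le fun st hst => ?_
  have hlaw : (feedbackLaw M draw st).map (fun w => w.responses.2) =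
      M.trajLaw (PMF.pure πref) := by
    rw [← sampler_eq_pure_of_mem_support_run hst, ← M.pairLaw_map_snd st.cur,
      ← feedbackLaw_map_responses M draw st, PMF.map_comp]
    rfl
  calc expMoment ((feedbackLaw M draw st).map (Prod.mk st)) (fun z =>
        hoeffdingExponent (M.trajLaw (PMF.pure πref)) f B l (z.1.seconds ++ [z.2.responses.2]))
      = expMoment ((feedbackLaw M draw st).map fun w => w.responses.2) fun τ =>
          hoeffdingExponent (M.trajLaw (PMF.pure πref)) f B l (st.seconds ++ [τ]) := by
        rw [expMoment_map, expMoment_map]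
    _ ≤ _ := by
        rw [hlaw]
        exact expMoment_hoeffdingExponent_concat_le
          (fun τ hτ => hB τ (M.admissible_of_mem_support_trajLaw hτ)) l st.seconds

lemma expMoment_hoeffdingExponent_seconds_le_one (hB : ∀ τ, M.Admissible τ → |f τ| ≤ B)
    (l : ℝ) (n : ℕ) :
    expMoment (run M πref (refStrategy πref) sel draw n) (fun st =>
      hoeffdingExponent (M.trajLaw (PMF.pure πref)) f B l st.seconds) ≤ 1 := by
  induction n with
  | zero => simp [run, hoeffdingExponent]
  | succ n ih =>
    rw [run_succ_eq_map_iterationLaw, expMoment_map]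
    exact (expMoment_hoeffdingExponent_seconds_concat_le hB l n).trans ih

end Seconds

lemma concentrates_seconds (hr : Realizable M πref Pol β V R πstar) :
    Concentrates M πref Pol β V R πstar (refStrategy πref) sel
      (fun _ seconds => PMF.pure seconds) where
  admissible _ l hl opt hopt := by
    obtain rfl := (PMF.mem_support_pure_iff _ _).1 hopt
    exact ⟨rfl, hl⟩
  deviation n π hπ l := by
    have hB : ∀ τ, M.Admissible τ → |DCMDP.ratioGap πref β π πstar τ| ≤ 2 * (V + R) :=
      fun τ hτ => hr.abs_ratioGap_le hπ hτ
    refine le_trans (expMoment_mono fun z hz => ?_)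
      ((expMoment_hoeffdingExponent_seconds_concat_le hB l n).trans
        (expMoment_hoeffdingExponent_seconds_le_one hB l n))
    obtain ⟨hst, hw⟩ := mem_support_iterationLaw hz
    rw [sampler_eq_pure_of_mem_support_run hst,
      (PMF.mem_support_pure_iff _ _).1 (mem_support_feedbackLaw hw).2]

/-! ### The regret bound of a single iteration -/

/-- The regret bound for the policy `p n`, with a confidence parameter `ℓ`. -/
def RegretEvent (M : DCMDP S A H) (πref : Policy S A) (β V R α ℓ : ℝ) (samp : Strategy S A)
    (πstar : Policy S A) (p : ℕ → Policy S A) (n : ℕ) : Prop :=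
  M.J πref β πstar - M.J πref β (p n) ≤
    expect (M.pairLaw (p n) (sampSeq πref samp p n)) (M.discrepancy πref β (p n)) +
      β / (α * n) * (4 * ℓ - 2 * (cumSq M πref β samp p n (p n) / infoConst V R)) +
      4 * (V + R) * √(ℓ / n)

lemma regretEvent_congr {p p' : ℕ → Policy S A} (h : ∀ i ≤ n, p i = p' i) :
    RegretEvent M πref β V R α ℓ samp πstar p n ↔
      RegretEvent M πref β V R α ℓ samp πstar p' n := by
  rw [RegretEvent, RegretEvent, h n le_rfl, sampSeq_congr πref samp fun i hi => h i hi.le,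
    cumSq_congr M πref β samp fun i hi => h i hi.le]

lemma IsArgmin.mul_sum_log_polProb_sub_le (hsel : IsArgmin πref Pol β α sel) (hπ : π ∈ Pol)
    (st : State S A) (prefs : List (Traj S A × Traj S A)) (opt : List (Traj S A)) :
    α * ((opt.map fun τ => Real.log (polProb (sel st prefs opt) τ)).sum -
        (opt.map fun τ => Real.log (polProb π τ)).sum) ≤
      (prefs.map (logLik πref β (sel st prefs opt))).sum -
        (prefs.map (logLik πref β π)).sum := by
  have hmin := (hsel st prefs opt).2 π hπ
  simp only [objective] at hmin
  unfold logLik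
  rw [mul_sub]
  linarith

lemma Reached.regretEvent_advance (h : Reached M πref Pol samp πstar n st)
    (hr : Realizable M πref Pol β V R πstar) (hsel : IsArgmin πref Pol β α sel) (hα : 0 < α)
    (hℓ : 0 < ℓ) (hlen : w.opt.length = n + 1) (hopt : ∀ τ ∈ w.opt, M.Admissible τ)
    (hlik : ∀ π ∈ Pol, likelihoodExponent M πref β V R samp πstar π (st.advance samp sel w) ≤ 2 * ℓ)
    (hdev : ∀ π ∈ Pol, hoeffdingExponent (M.trajLaw st.sampler) (DCMDP.ratioGap πref β π πstar)
      (2 * (V + R)) (2 * √(ℓ / (n + 1 : ℕ)) / (2 * (V + R))) w.opt ≤ 2 * ℓ) :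
    RegretEvent M πref β V R α ℓ samp πstar ((st.advance samp sel w).seq πstar) (n + 1) := by
  set π := sel st (st.prefs ++ [w.comparison]) w.opt
  have hπ : π ∈ Pol := (hsel _ _ _).1
  have hseq : (st.advance samp sel w).seq πstar (n + 1) = π := by
    rw [← h.past_length, State.seq_advance_succ]
  set Q := cumSq M πref β samp ((st.advance samp sel w).seq πstar) (n + 1) π / infoConst V R
  have hsum : (w.opt.map (DCMDP.ratioGap πref β π πstar)).sum ≤ β / α * (4 * ℓ - 2 * Q) := by
    have hargmin := hsel.mul_sum_log_polProb_sub_le hr.mem st (st.prefs ++ [w.comparison]) w.opt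
    have hin := hlik π hπ
    rw [likelihoodExponent, State.past_length_advance, h.past_length] at hin
    rw [hr.sum_ratioGap hπ hopt, div_mul_eq_mul_div, mul_div_assoc]
    refine mul_le_mul_of_nonneg_left ?_ hr.beta_pos.le
    rw [le_div_iff₀' hα]
    exact hargmin.trans (by linarith! only [hin])
  have hmean := expect_le_of_hoeffdingExponent_le (mul_pos two_pos hr.pos) hℓ
    (hlen ▸ n.succ_pos) (hlen ▸ hdev π hπ)
  have hn : (0 : ℝ) < (n + 1 : ℕ) := Nat.cast_pos.2 n.succ_pos
  have havg := div_le_div_of_nonneg_right hsum hn.le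
  have hsplit : β / (α * (n + 1 : ℕ)) * (4 * ℓ - 2 * Q) =
      β / α * (4 * ℓ - 2 * Q) / (n + 1 : ℕ) := by rw [← div_div, div_mul_eq_mul_div]
  rw [hlen] at hmean
  rw [RegretEvent, hseq, h.sampSeq_advance, hr.J_sub_J_eq hπ st.sampler, hsplit]
  linarith

/-! ### The regret bound holds with high probability -/

lemma toOuterMeasure_run_not_regretEvent_succ_le (hr : Realizable M πref Pol β V R πstar)
    (hsel : IsArgmin πref Pol β α sel) (hc : Concentrates M πref Pol β V R πstar samp sel draw)
    (hα : 0 < α) (hℓ : 0 < ℓ) (n : ℕ) :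
    (run M πref samp sel draw (n + 1)).toOuterMeasure
        {st | ¬ RegretEvent M πref β V R α ℓ samp πstar (st.seq πstar) (n + 1)} ≤
      2 * (Pol.card * ENNReal.ofReal (Real.exp (-(2 * ℓ)))) := by
  set p := iterationLaw M πref samp sel draw n
  set lik : Policy S A → State S A × Feedback S A → ℝ := fun π z =>
    likelihoodExponent M πref β V R samp πstar π (z.1.advance samp sel z.2)
  set dev : Policy S A → State S A × Feedback S A → ℝ := fun π z =>
    hoeffdingExponent (M.trajLaw z.1.sampler) (DCMDP.ratioGap πref β π πstar) (2 * (V + R))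
      (2 * √(ℓ / (n + 1 : ℕ)) / (2 * (V + R))) z.2.opt
  have hlik : ∀ π ∈ Pol, expMoment p (lik π) ≤ 1 := fun π hπ => by
    have hrun := expMoment_likelihoodExponent_le_one (samp := samp) (draw := draw) hr
      (fun st prefs opt => (hsel st prefs opt).1) hπ (n + 1)
    rwa [run_succ_eq_map_iterationLaw, expMoment_map] at hrun
  have hdev : ∀ π ∈ Pol, expMoment p (dev π) ≤ 1 := fun π hπ => hc.deviation n π hπ _
  rw [run_succ_eq_map_iterationLaw, PMF.toOuterMeasure_map_apply]
  calc p.toOuterMeasure ((fun z => z.1.advance samp sel z.2) ⁻¹'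
        {st | ¬ RegretEvent M πref β V R α ℓ samp πstar (st.seq πstar) (n + 1)})
      ≤ p.toOuterMeasure ({z | ∃ π ∈ Pol, 2 * ℓ < lik π z} ∪ {z | ∃ π ∈ Pol, 2 * ℓ < dev π z}) := by
        refine PMF.toOuterMeasure_mono p fun z ⟨hbad, hz⟩ => ?_
        by_contra hgood
        simp only [Set.mem_union, Set.mem_ofPred_eq, not_or, not_exists, not_and, not_lt] at hgood
        obtain ⟨hst, hw⟩ := mem_support_iterationLaw hz
        obtain ⟨hpair, hopt⟩ := mem_support_feedbackLaw hw
        have h := reached_of_mem_support_run hr.mem (fun st prefs opt => (hsel st prefs opt).1) hst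
        obtain ⟨hlen, hadm⟩ := hc.admissible _ _ (h.admissible_seconds_concat hpair) _ hopt
        rw [List.length_append, h.seconds_length, List.length_singleton] at hlen
        exact hbad (h.regretEvent_advance hr hsel hα hℓ hlen hadm hgood.1 hgood.2)
    _ ≤ _ := MeasureTheory.measure_union_le _ _
    _ ≤ _ := (add_le_add (toOuterMeasure_exists_lt_le_of_expMoment_le_one hlik _)
        (toOuterMeasure_exists_lt_le_of_expMoment_le_one hdev _)).trans_eq (two_mul _).symm

lemma toOuterMeasure_run_succ_not_regretEvent_le (hd : πstar ∈ Pol)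
    (hsel : ∀ st prefs opt, sel st prefs opt ∈ Pol) {n k : ℕ} (hn : n ≤ k) :
    (run M πref samp sel draw (k + 1)).toOuterMeasure
        {st | ¬ RegretEvent M πref β V R α ℓ samp πstar (st.seq πstar) n} ≤
      (run M πref samp sel draw k).toOuterMeasure
        {st | ¬ RegretEvent M πref β V R α ℓ samp πstar (st.seq πstar) n} := by
  rw [← iterationLaw_map_fst M πref samp sel draw k, run_succ_eq_map_iterationLaw,
    PMF.toOuterMeasure_map_apply, PMF.toOuterMeasure_map_apply]
  refine PMF.toOuterMeasure_mono _ fun z ⟨hbad, hz⟩ => ?_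
  have h := reached_of_mem_support_run hd hsel (mem_support_iterationLaw hz).1
  refine mt (regretEvent_congr fun i hi => ?_).1 hbad
  exact (State.seq_advance_of_le (h.past_length.ge.trans' (hi.trans hn))).symm

lemma toOuterMeasure_run_exists_not_regretEvent_le (hr : Realizable M πref Pol β V R πstar)
    (hsel : IsArgmin πref Pol β α sel) (hc : Concentrates M πref Pol β V R πstar samp sel draw)
    (hα : 0 < α) (hℓ : 0 < ℓ) (T : ℕ) :
    (run M πref samp sel draw T).toOuterMeasure
        {st | ∃ n ∈ Finset.Icc 1 T, ¬ RegretEvent M πref β V R α ℓ samp πstar (st.seq πstar) n} ≤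
      T * (2 * (Pol.card * ENNReal.ofReal (Real.exp (-(2 * ℓ))))) := by
  have hevent : ∀ n ∈ Finset.Icc 1 T, (run M πref samp sel draw T).toOuterMeasure
      {st | ¬ RegretEvent M πref β V R α ℓ samp πstar (st.seq πstar) n} ≤
        2 * (Pol.card * ENNReal.ofReal (Real.exp (-(2 * ℓ)))) := by
    intro n hn
    obtain ⟨hone, hT⟩ := Finset.mem_Icc.1 hn
    induction T, hT using Nat.le_induction with
    | base =>
      obtain ⟨m, rfl⟩ := Nat.exists_eq_add_of_le' hone
      exact toOuterMeasure_run_not_regretEvent_succ_le hr hsel hc hα hℓ m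
    | succ k hk ih =>
      exact (toOuterMeasure_run_succ_not_regretEvent_le hr.mem
        (fun st prefs opt => (hsel st prefs opt).1) hk).trans (ih (Finset.mem_Icc.2 ⟨hone, hk⟩))
  have hunion : {st : State S A | ∃ n ∈ Finset.Icc 1 T,
      ¬ RegretEvent M πref β V R α ℓ samp πstar (st.seq πstar) n} = ⋃ n ∈ Finset.Icc 1 T,
        {st | ¬ RegretEvent M πref β V R α ℓ samp πstar (st.seq πstar) n} := by
    ext; simp
  rw [hunion]
  refine (MeasureTheory.measure_biUnion_finset_le _ _).trans
    ((Finset.sum_le_sum hevent).trans_eq ?_)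
  rw [Finset.sum_const, Nat.card_Icc, Nat.add_sub_cancel, nsmul_eq_mul]

lemma mul_exp_neg_two_mul_logTerm_le {card T : ℕ} {δ : ℝ} (hcard : 0 < card) (hT : 0 < T)
    (hδ : 0 < δ) (hℓ : Real.log 2 ≤ logTerm card T δ) :
    T * (2 * (card * Real.exp (-(2 * logTerm card T δ)))) ≤ δ := by
  have hcard' : (0 : ℝ) < card := Nat.cast_pos.2 hcard
  have hT' : (0 : ℝ) < T := Nat.cast_pos.2 hT
  have hexp : Real.exp (-logTerm card T δ) = δ / (card * T) := by
    rw [Real.exp_neg, logTerm, Real.exp_log (mul_pos (mul_pos hcard' hT') (inv_pos.2 hδ)), mul_inv,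
      inv_inv, div_eq_inv_mul]
  have hhalf : Real.exp (-logTerm card T δ) ≤ 1 / 2 := by
    rw [one_div, Real.exp_neg]
    exact inv_anti₀ two_pos ((Real.log_le_iff_le_exp two_pos).1 hℓ)
  calc T * (2 * (card * Real.exp (-(2 * logTerm card T δ))))
      = T * (2 * (card * (Real.exp (-logTerm card T δ) * Real.exp (-logTerm card T δ)))) := by
        rw [← Real.exp_add]
        ring_nf
    _ ≤ T * (2 * (card * (1 / 2 * (δ / (card * T))))) := by
        gcongr
        exact hexp.le
    _ = δ := by field_simp

lemma toOuterMeasure_run_exists_not_regretEvent_le_ofReal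
    (hr : Realizable M πref Pol β V R πstar) (hsel : IsArgmin πref Pol β α sel)
    (hc : Concentrates M πref Pol β V R πstar samp sel draw) (hα : 0 < α) {δ : ℝ} (hδ : 0 < δ)
    {T : ℕ} (hT : 0 < T) (hℓ : Real.log 2 ≤ logTerm Pol.card T δ) :
    (run M πref samp sel draw T).toOuterMeasure {st | ∃ n ∈ Finset.Icc 1 T,
        ¬ RegretEvent M πref β V R α (logTerm Pol.card T δ) samp πstar (st.seq πstar) n} ≤
      ENNReal.ofReal δ := by
  have hℓ' : 0 < logTerm Pol.card T δ := (Real.log_pos one_lt_two).trans_le hℓ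
  refine (toOuterMeasure_run_exists_not_regretEvent_le hr hsel hc hα hℓ' T).trans ?_
  have hreal := mul_exp_neg_two_mul_logTerm_le (Finset.card_pos.2 ⟨πstar, hr.mem⟩) hT hδ hℓ
  refine le_trans (le_of_eq ?_) (ENNReal.ofReal_le_ofReal hreal)
  rw [ENNReal.ofReal_mul (Nat.cast_nonneg _), ENNReal.ofReal_mul two_pos.le,
    ENNReal.ofReal_mul (Nat.cast_nonneg _), ENNReal.ofReal_natCast, ENNReal.ofReal_natCast,
    ENNReal.ofReal_ofNat]

end Concentration

/-! ### Summing the regret bounds -/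

section Summation

lemma sum_inv_sqrt_le (T : ℕ) : ∑ n ∈ Finset.Icc 1 T, 1 / √(n : ℝ) ≤ 2 * √(T : ℝ) := by
  induction T with
  | zero => simp
  | succ T ih =>
    rw [Finset.sum_Icc_succ_top (Nat.le_add_left 1 T)]
    set a := √(T : ℝ)
    set b := √((T + 1 : ℕ) : ℝ)
    have ha : a ^ 2 = T := Real.sq_sqrt (Nat.cast_nonneg T)
    have hb : b ^ 2 = T + 1 := (Real.sq_sqrt (Nat.cast_nonneg _)).trans (Nat.cast_succ T)
    have hb_pos : 0 < b := Real.sqrt_pos.2 (Nat.cast_pos.2 T.succ_pos)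
    have hstep : 1 / b ≤ 2 * b - 2 * a := by
      rw [div_le_iff₀ hb_pos]
      nlinarith [sq_nonneg (b - a)]
    linarith

lemma sum_inv_le (T : ℕ) : ∑ n ∈ Finset.Icc 1 T, 1 / (n : ℝ) ≤ 1 + Real.log T := by
  simpa [harmonic_eq_sum_Icc] using harmonic_le_one_add_log T

lemma one_le_log_of_three_le {x : ℝ} (hx : 3 ≤ x) : 1 ≤ Real.log x :=
  (Real.le_log_iff_exp_le (by positivity)).2 (Real.exp_one_lt_three.le.trans hx)

lemma mul_le_of_forall_le {a b d g s : ℝ} {t : ℕ → ℝ} {T : ℕ} {I : Finset ℕ} (ha : 0 ≤ a)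
    (hb : 0 ≤ b) (hd : 0 ≤ d) (hg : 0 ≤ g) (hT : 3 ≤ T) (hI : I ⊆ Finset.Icc 1 T)
    (hcard : T ≤ 3 * I.card) (ht : ∀ n ∈ I, 0 ≤ t n) (hsum : ∑ n ∈ I, t n ≤ s)
    (h : ∀ n ∈ I, g ≤ a * (n * t n) + b * (1 / n) + d * (1 / √n)) :
    T / 3 * g ≤ a * (T * s) + b * (2 * Real.log T) + d * (2 * √T) := by
  have hlog : 1 ≤ Real.log T := one_le_log_of_three_le (by exact_mod_cast hT)
  have hweighted : ∑ n ∈ I, n * t n ≤ T * s := by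
    refine le_trans ?_ (mul_le_mul_of_nonneg_left hsum (Nat.cast_nonneg T))
    rw [Finset.mul_sum]
    refine Finset.sum_le_sum fun n hn => mul_le_mul_of_nonneg_right ?_ (ht n hn)
    exact_mod_cast (Finset.mem_Icc.1 (hI hn)).2
  have hinv : ∑ n ∈ I, 1 / (n : ℝ) ≤ 2 * Real.log T :=
    calc ∑ n ∈ I, 1 / (n : ℝ) ≤ ∑ n ∈ Finset.Icc 1 T, 1 / (n : ℝ) :=
          Finset.sum_le_sum_of_subset_of_nonneg hI fun n _ _ => by positivity
      _ ≤ 2 * Real.log T := (sum_inv_le T).trans (by linarith)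
  have hinv_sqrt : ∑ n ∈ I, 1 / √(n : ℝ) ≤ 2 * √T :=
    (Finset.sum_le_sum_of_subset_of_nonneg hI fun n _ _ => by positivity).trans (sum_inv_sqrt_le T)
  have hthird : (T : ℝ) / 3 ≤ I.card := by
    rw [div_le_iff₀' three_pos]
    exact_mod_cast hcard
  calc (T : ℝ) / 3 * g ≤ ∑ _n ∈ I, g := by
        rw [Finset.sum_const, nsmul_eq_mul]
        exact mul_le_mul_of_nonneg_right hthird hg
    _ ≤ ∑ n ∈ I, (a * (n * t n) + b * (1 / n) + d * (1 / √n)) := Finset.sum_le_sum h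
    _ = a * ∑ n ∈ I, n * t n + b * ∑ n ∈ I, 1 / (n : ℝ) + d * ∑ n ∈ I, 1 / √(n : ℝ) := by
        simp only [Finset.sum_add_distrib, Finset.mul_sum]
    _ ≤ _ := by gcongr

lemma le_add_of_sq_le_mul {e t b η : ℝ} (hη : 0 < η) (ht : 0 ≤ t) (hb : 0 ≤ b)
    (h : e ^ 2 ≤ t * b) : e ≤ η / 4 * t + b / η := by
  refine le_of_sq_le_sq (h.trans ?_) (by positivity)
  have hprod : t * b = 4 * (η / 4 * t) * (b / η) := by field_simp
  linarith [four_mul_le_sq_add (η / 4 * t) (b / η)]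

section Iteration

variable {S A : Type*} {H : ℕ} {M : DCMDP S A H} {πref πstar : Policy S A} {samp : Strategy S A}
  {β α V R ℓ : ℝ} {p : ℕ → Policy S A} {n : ℕ}

lemma cumSq_nonneg (M : DCMDP S A H) (πref : Policy S A) (β : ℝ) (samp : Strategy S A)
    (p : ℕ → Policy S A) (n : ℕ) (π : Policy S A) : 0 ≤ cumSq M πref β samp p n π :=
  Finset.sum_nonneg fun _ _ => expect_nonneg fun _ _ => sq_nonneg _

lemma RegretEvent.le_of_sq_le (h : RegretEvent M πref β V R α ℓ samp πstar p n) {t : ℝ}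
    (hn : 0 < n) (hα : 0 < α) (hβ : 0 < β) (hR : 0 ≤ R) (hW : 0 < V + R) (hℓ : 1 / 72 ≤ ℓ)
    (ht : 0 ≤ t)
    (hsq : expect (M.pairLaw (p n) (sampSeq πref samp p n)) (M.discrepancy πref β (p n)) ^ 2 ≤
      t * (cumSq M πref β samp p n (p n) + 4 * (V + R) ^ 2)) :
    M.J πref β πstar - M.J πref β (p n) ≤ α * infoConst V R / (8 * β) * (n * t) +
      5 * (β * ℓ / α) * (1 / n) + 4 * (V + R) * √ℓ * (1 / √n) := by
  have hn' : (0 : ℝ) < n := Nat.cast_pos.2 hn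
  have hK := infoConst_pos hW
  set K := infoConst V R
  set Q := cumSq M πref β samp p n (p n)
  set E := expect (M.pairLaw (p n) (sampSeq πref samp p n)) (M.discrepancy πref β (p n))
  have hQ : 0 ≤ Q := cumSq_nonneg M πref β samp p n (p n)
  have hslack : 8 * (V + R) ^ 2 / K ≤ ℓ := by
    refine le_trans ?_ hℓ
    rw [div_le_iff₀ hK]
    linarith [sq_le_infoConst (V := V) hR]
  have hsqrt : √(ℓ / n) = √ℓ * (1 / √n) := by rw [Real.sqrt_div' _ hn'.le, mul_one_div]
  -- This weight in AM-GM makes the in-sample error `Q` cancel against the likelihood bound.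
  have hE : E ≤ α * K / (8 * β) * (n * t) + β / (α * n) * (2 * (Q / K) + ℓ) :=
    calc E ≤ α * n * K / (2 * β) / 4 * t + (Q + 4 * (V + R) ^ 2) / (α * n * K / (2 * β)) :=
          le_add_of_sq_le_mul (by positivity) ht (by positivity) hsq
      _ = α * K / (8 * β) * (n * t) + β / (α * n) * (2 * (Q / K) + 8 * (V + R) ^ 2 / K) := by
          field_simp
          ring
      _ ≤ _ := by gcongr
  calc M.J πref β πstar - M.J πref β (p n)
      ≤ E + β / (α * n) * (4 * ℓ - 2 * (Q / K)) + 4 * (V + R) * √(ℓ / n) := h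
    _ ≤ α * K / (8 * β) * (n * t) + β / (α * n) * (2 * (Q / K) + ℓ) +
          β / (α * n) * (4 * ℓ - 2 * (Q / K)) + 4 * (V + R) * √(ℓ / n) := by gcongr
    _ = _ := by
        rw [hsqrt]
        field_simp
        ring

end Iteration

lemma sqrt_div_mul_le {ℓ L s T : ℝ} (hℓ : 0 ≤ ℓ) (hL : 0 ≤ L) (hs : 0 < s) (hT : 0 < T) :
    √(ℓ * L / (T * s)) * s ≤ √(max (s * L) 1 * ℓ / T) := by
  refine Real.le_sqrt_of_sq_le ?_
  calc (√(ℓ * L / (T * s)) * s) ^ 2 = s * L * ℓ / T := by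
        rw [mul_pow, Real.sq_sqrt (by positivity)]
        field_simp
    _ ≤ max (s * L) 1 * ℓ / T := by
        gcongr
        exact le_max_left _ _

lemma sqrt_mul_sqrt_le_mul_sqrt_max {ℓ T : ℝ} (hℓ : 0 ≤ ℓ) (hT : 0 ≤ T) (x : ℝ) :
    √ℓ * √T ≤ T * √(max x 1 * ℓ / T) :=
  calc √ℓ * √T = T * √(ℓ / T) := by
        rw [Real.sqrt_div hℓ, mul_div_left_comm, Real.div_sqrt]
    _ ≤ T * √(max x 1 * ℓ / T) := by
        gcongr
        exact le_mul_of_one_le_left hℓ (le_max_right _ _)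

section Rate

variable {c g β V R δ sec : ℝ} {card T : ℕ}

/-- The constant of the regret bound: three times the sum of the constants `72 * c`, `10 / c` and
`8` of its three terms, since only a third of the iterations may be summed over. -/
def rateConst (c : ℝ) : ℝ := 3 * (72 * c + 10 / c + 8)

lemma rateConst_pos (hc : 0 < c) : 0 < rateConst c := by
  unfold rateConst
  positivity

lemma rate_nonneg (hW : 0 ≤ V + R) (card T : ℕ) (δ sec : ℝ) : 0 ≤ rate V R card T δ sec :=
  mul_nonneg (mul_nonneg hW (Real.exp_pos _).le) (Real.sqrt_nonneg _)

lemma alphaParam_pos (hc : 0 < c) (hβ : 0 < β) (hW : 0 < V + R) (hT : 1 < T) (hsec : 0 < sec)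
    (hℓ : 0 < logTerm card T δ) : 0 < alphaParam c β V R card T δ sec := by
  have hlog : 0 < Real.log T := Real.log_pos (Nat.one_lt_cast.2 hT)
  have hT' : (0 : ℝ) < T := Nat.cast_pos.2 (one_pos.trans hT)
  exact mul_pos (mul_pos hc (by positivity))
    (Real.sqrt_pos.2 (div_pos (mul_pos hℓ hlog) (mul_pos hT' hsec)))

lemma alphaParam_mul_infoConst_le (hc : 0 ≤ c) (hβ : 0 < β) (hR : 0 ≤ R) (hW : 0 < V + R)
    (hT : 0 < T) (hsec : 0 < sec) (hℓ : 0 ≤ logTerm card T δ) :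
    alphaParam c β V R card T δ sec * infoConst V R / (8 * β) * (T * sec) ≤
      72 * c * (T * rate V R card T δ sec) := by
  set q := √(logTerm card T δ * Real.log T / (T * sec)) with hq
  set m := √(max (sec * Real.log T) 1 * logTerm card T δ / T) with hm
  have hqm : q * sec ≤ m :=
    sqrt_div_mul_le hℓ (Real.log_natCast_nonneg T) hsec (Nat.cast_pos.2 hT)
  calc alphaParam c β V R card T δ sec * infoConst V R / (8 * β) * (T * sec)
      = 72 * c * (T * ((V + R) * 1 * (q * sec))) := by
        rw [alphaParam, infoConst, ← hq]
        field_simp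
        ring
    _ ≤ 72 * c * (T * rate V R card T δ sec) := by
        rw [rate, ← hm]
        gcongr
        exact Real.one_le_exp (by positivity)

lemma div_alphaParam_le (hc : 0 < c) (hβ : 0 < β) (hW : 0 < V + R) (hT : 1 < T) (hsec : 0 < sec)
    (hℓ : 0 < logTerm card T δ) :
    5 * (β * logTerm card T δ / alphaParam c β V R card T δ sec) * (2 * Real.log T) ≤
      10 / c * (T * rate V R card T δ sec) := by
  have hlog : 0 < Real.log T := Real.log_pos (Nat.one_lt_cast.2 hT)
  have hT' : (0 : ℝ) < T := Nat.cast_pos.2 (one_pos.trans hT)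
  set ℓ := logTerm card T δ
  set q := √(ℓ * Real.log T / (T * sec)) with hq
  have hq_pos : 0 < q := Real.sqrt_pos.2 (by positivity)
  have hq_sq : ℓ * Real.log T = q ^ 2 * (T * sec) := by
    rw [hq, Real.sq_sqrt (by positivity)]
    field_simp
  calc 5 * (β * ℓ / alphaParam c β V R card T δ sec) * (2 * Real.log T)
      = 10 / c * ((V + R) * Real.exp (2 * R) * (ℓ * Real.log T / q)) := by
        rw [alphaParam, ← hq]
        field_simp
        ring
    _ = 10 / c * (T * ((V + R) * Real.exp (2 * R) * (q * sec))) := by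
        rw [hq_sq]
        field_simp
    _ ≤ 10 / c * (T * rate V R card T δ sec) := by
        rw [rate]
        gcongr
        exact sqrt_div_mul_le hℓ.le hlog.le hsec hT'

lemma sqrt_logTerm_mul_le (hR : 0 ≤ R) (hW : 0 ≤ V + R) (hℓ : 0 ≤ logTerm card T δ) :
    4 * (V + R) * √(logTerm card T δ) * (2 * √T) ≤ 8 * (T * rate V R card T δ sec) := by
  set m := √(max (sec * Real.log T) 1 * logTerm card T δ / T) with hm
  calc 4 * (V + R) * √(logTerm card T δ) * (2 * √T)
      = 8 * ((V + R) * 1 * (√(logTerm card T δ) * √T)) := by ring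
    _ ≤ 8 * ((V + R) * Real.exp (2 * R) * (T * m)) := by
        gcongr 8 * ((V + R) * ?_ * ?_)
        · exact Real.one_le_exp (by positivity)
        · exact sqrt_mul_sqrt_le_mul_sqrt_max hℓ (Nat.cast_nonneg T) _
    _ = 8 * (T * rate V R card T δ sec) := by
        rw [rate, ← hm]
        ring

lemma le_rate_of_mul_le (hc : 0 < c) (hβ : 0 < β) (hR : 0 ≤ R) (hW : 0 < V + R) (hT : 1 < T)
    (hsec : 0 < sec) (hℓ : 0 < logTerm card T δ)
    (h : T / 3 * g ≤ alphaParam c β V R card T δ sec * infoConst V R / (8 * β) * (T * sec) +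
      5 * (β * logTerm card T δ / alphaParam c β V R card T δ sec) * (2 * Real.log T) +
      4 * (V + R) * √(logTerm card T δ) * (2 * √T)) :
    g ≤ rateConst c * rate V R card T δ sec := by
  have hT' : 0 < T := one_pos.trans hT
  refine le_of_mul_le_mul_left ?_ (show (0 : ℝ) < T / 3 by positivity)
  calc T / 3 * g ≤ 72 * c * (T * rate V R card T δ sec) + 10 / c * (T * rate V R card T δ sec) +
        8 * (T * rate V R card T δ sec) :=
        h.trans (add_le_add_three (alphaParam_mul_infoConst_le hc.le hβ hR hW hT' hsec hℓ.le)
          (div_alphaParam_le hc hβ hW hT hsec hℓ) (sqrt_logTerm_mul_le hR hW.le hℓ.le))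
    _ = T / 3 * (rateConst c * rate V R card T δ sec) := by
        rw [rateConst]
        ring

lemma le_rate_of_le_two (hc : 0 < c) (hR : 0 ≤ R) (hW : 0 ≤ V + R) (hT₀ : 0 < T) (hT : T ≤ 2)
    (hℓ : Real.log 2 ≤ logTerm card T δ) :
    V + R ≤ rateConst c * rate V R card T δ sec := by
  have hsqrt : 1 / 3 ≤ √(max (sec * Real.log T) 1 * logTerm card T δ / T) := by
    refine Real.le_sqrt_of_sq_le ((le_div_iff₀ (Nat.cast_pos.2 hT₀)).2 ?_)
    have hT' : (T : ℝ) ≤ 2 := by exact_mod_cast hT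
    have hmax : logTerm card T δ ≤ max (sec * Real.log T) 1 * logTerm card T δ :=
      le_mul_of_one_le_left (by linarith [Real.log_two_gt_d9]) (le_max_right _ _)
    linarith [Real.log_two_gt_d9]
  have hconst : 24 ≤ rateConst c := by
    have : 0 < 72 * c + 10 / c := by positivity
    rw [rateConst]
    linarith
  calc V + R ≤ 24 * ((V + R) * 1 * (1 / 3)) := by linarith
    _ ≤ rateConst c * rate V R card T δ sec := by
      unfold rate
      gcongr
      exact Real.one_le_exp (by positivity)

end Rate

end Summation

/-! ### The Sequential Extrapolation Coefficient along the run -/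

section Main

variable {S A : Type*} {H : ℕ} {M : DCMDP S A H} {πref πstar πhat π : Policy S A}
  {Pol : Finset (Policy S A)} {samp : Strategy S A} {sel : Selector S A}
  {draw : MixedPolicy S A → List (Traj S A) → PMF (List (Traj S A))} {β V R c δ sec : ℝ} {T : ℕ}
  {p : ℕ → Policy S A}

namespace DCMDP

lemma sub_one_mul_muExpect (M : DCMDP S A H) (samp : Strategy S A) (p : ℕ → Policy S A) (t : ℕ)
    (f : Traj S A × Traj S A → ℝ) :
    ((t : ℝ) - 1) * M.muExpect samp p t f =
      ∑ i ∈ Finset.Ico 1 t, expect (M.pairLaw (p i) (tilde samp p i)) f := by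
  rw [muExpect]
  rcases eq_or_ne (t : ℝ) 1 with ht | ht
  · obtain rfl : t = 1 := Nat.cast_eq_one.1 ht
    simp
  · exact mul_inv_cancel_left₀ (sub_ne_zero.2 ht) _

lemma secTerm_nonneg (M : DCMDP S A H) (πref : Policy S A) (β V : ℝ) (samp : Strategy S A)
    (p : ℕ → Policy S A) (t : ℕ) : 0 ≤ M.secTerm πref β V samp p t :=
  div_nonneg (sq_nonneg _) ((sq_nonneg V).trans (le_max_left _ _))

lemma sum_secTerm_le_SEC (hsec : 0 < M.SEC πref Pol T β V samp) (hp : ∀ t, p t ∈ Pol) :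
    ∑ t ∈ Finset.Icc 1 T, M.secTerm πref β V samp p t ≤ M.SEC πref Pol T β V samp := by
  refine le_ciSup (f := fun p : {p : ℕ → Policy S A // ∀ t, p t ∈ Pol} =>
    ∑ t ∈ Finset.Icc 1 T, M.secTerm πref β V samp p.1 t) ?_ ⟨p, hp⟩
  -- An unbounded real supremum is `0`, contradicting `hsec`.
  by_contra hbdd
  rw [SEC, Real.iSup_of_not_bddAbove hbdd] at hsec
  exact lt_irrefl _ hsec

end DCMDP

lemma Realizable.sq_expect_le_secTerm_mul (hr : Realizable M πref Pol β V R πstar) {t : ℕ}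
    (hp : p t ∈ Pol) {B : ℝ}
    (hB : ∑ i ∈ Finset.Ico 1 t, expect (M.pairLaw (p i) (DCMDP.tilde samp p i))
      (fun x => M.discrepancy πref β (p t) x ^ 2) ≤ B) (hVB : V ^ 2 ≤ B) :
    expect (M.pairLaw (p t) (DCMDP.tilde samp p (t - 1))) (M.discrepancy πref β (p t)) ^ 2 ≤
      M.secTerm πref β V samp p t * B := by
  rcases hr.V_nonneg.eq_or_lt with rfl | hV
  -- For `V = 0` the SEC term may be a quotient by `0`, but then every policy is calibrated.
  · have hcal := hr.calibrated.of_boundedRatio_zero hr.ratio hr.beta_pos hp hr.mem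
    rw [expect_congr (g := fun _ => 0) fun x hx =>
      hcal x (M.admissiblePair_of_mem_support_pairLaw hx), expect_const, zero_pow two_ne_zero]
    exact mul_nonneg (M.secTerm_nonneg πref β 0 samp p t) ((sq_nonneg _).trans hVB)
  · rw [DCMDP.secTerm, M.sub_one_mul_muExpect, div_mul_eq_mul_div,
      le_div_iff₀ (lt_max_of_lt_left (by positivity))]
    gcongr
    exact max_le hVB hB

/-- For a constant fraction of the policies `p n`, the expected discrepancy is bounded in terms of
the in-sample error, with weights `t n` whose sum is at most `sec`. -/
def Controlled (M : DCMDP S A H) (πref : Policy S A) (β V R : ℝ) (samp : Strategy S A) (T : ℕ)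
    (sec : ℝ) (p : ℕ → Policy S A) : Prop :=
  ∃ I ⊆ Finset.Icc 1 T, T ≤ 3 * I.card ∧ ∃ t : ℕ → ℝ, (∀ n ∈ I, 0 ≤ t n) ∧ ∑ n ∈ I, t n ≤ sec ∧
    ∀ n ∈ I, expect (M.pairLaw (p n) (sampSeq πref samp p n)) (M.discrepancy πref β (p n)) ^ 2 ≤
      t n * (cumSq M πref β samp p n (p n) + 4 * (V + R) ^ 2)

lemma Realizable.sq_le_cumSq_add (hr : Realizable M πref Pol β V R πstar) (samp : Strategy S A)
    (p : ℕ → Policy S A) (n : ℕ) (π : Policy S A) :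
    V ^ 2 ≤ cumSq M πref β samp p n π + 4 * (V + R) ^ 2 := by
  have hsq : V ^ 2 ≤ (V + R) ^ 2 :=
    pow_le_pow_left₀ hr.V_nonneg (le_add_of_nonneg_right hr.R_nonneg) 2
  linarith [cumSq_nonneg M πref β samp p n π, sq_nonneg (V + R)]

section GeneralStrategy

lemma tilde_sub_one_eq_sampSeq (πref : Policy S A) (samp : Strategy S A) (p : ℕ → Policy S A)
    {n : ℕ} (hn : 2 ≤ n) :
    DCMDP.tilde samp (fun t => p (t - 1)) n = sampSeq πref samp p n := by
  rw [sampSeq, if_neg (not_le.2 hn), DCMDP.tilde]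
  rfl

lemma sum_secTerm_shift_le (M : DCMDP S A H) (πref : Policy S A) (β V : ℝ) (samp : Strategy S A)
    (p : ℕ → Policy S A) (T : ℕ) :
    ∑ n ∈ Finset.Icc 2 (T - 1), M.secTerm πref β V samp p (n + 1) ≤
      ∑ t ∈ Finset.Icc 1 T, M.secTerm πref β V samp p t :=
  calc ∑ n ∈ Finset.Icc 2 (T - 1), M.secTerm πref β V samp p (n + 1)
      = ∑ t ∈ (Finset.Icc 2 (T - 1)).map (addRightEmbedding 1), M.secTerm πref β V samp p t := by
        rw [Finset.sum_map]
        rfl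
    _ ≤ ∑ t ∈ Finset.Icc 1 T, M.secTerm πref β V samp p t := by
        refine Finset.sum_le_sum_of_subset_of_nonneg (fun t ht => ?_)
          fun t _ _ => M.secTerm_nonneg πref β V samp p t
        simp only [Finset.mem_map, Finset.mem_Icc, addRightEmbedding_apply] at ht ⊢
        lia

lemma Realizable.sum_shift_le_cumSq_add (hr : Realizable M πref Pol β V R πstar) (hπ : π ∈ Pol)
    (samp : Strategy S A) (p : ℕ → Policy S A) {n : ℕ} (hn : 1 ≤ n) :
    ∑ i ∈ Finset.Ico 1 (n + 1), expect
        (M.pairLaw (p (i - 1)) (DCMDP.tilde samp (fun t => p (t - 1)) i))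
        (fun x => M.discrepancy πref β π x ^ 2) ≤
      cumSq M πref β samp p n π + 4 * (V + R) ^ 2 := by
  obtain ⟨k, rfl⟩ := Nat.exists_eq_add_of_le' hn
  rw [Finset.sum_Ico_eq_sum_range, cumSq, Nat.add_sub_cancel_right (m := 1), Finset.sum_range_succ',
    Finset.sum_range_succ' _ k, add_assoc (Finset.sum _ _)]
  refine add_le_add (Finset.sum_congr rfl fun i _ => ?_).le ?_
  · rw [tilde_sub_one_eq_sampSeq πref samp p (by lia), Nat.add_sub_cancel_left, add_comm 1]
  · exact (hr.ret.expect_sq_discrepancy_le hr.ratio hr.beta_pos hπ _ _).trans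
      (le_add_of_nonneg_left (expect_nonneg fun _ _ => sq_nonneg _))

lemma Realizable.controlled (hr : Realizable M πref Pol β V R πstar)
    (hsec : 0 < M.SEC πref Pol T β V samp) (hT : 3 ≤ T) (hp : ∀ n, p n ∈ Pol) :
    Controlled M πref β V R samp T (M.SEC πref Pol T β V samp) p := by
  -- `p n` plays the role of `π⁽ⁿ⁺¹⁾`. The SEC has only `T` terms, and the first iteration samples
  -- from `πref` rather than from `samp [πref]`; hence the range `2 ≤ n ≤ T - 1`.
  set p' : ℕ → Policy S A := fun t => p (t - 1)
  have hcard : T ≤ 3 * (Finset.Icc 2 (T - 1)).card := by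
    rw [Nat.card_Icc]
    lia
  refine ⟨Finset.Icc 2 (T - 1), Finset.Icc_subset_Icc one_le_two (Nat.sub_le T 1), hcard,
    fun n => M.secTerm πref β V samp p' (n + 1), fun n _ => M.secTerm_nonneg _ _ _ _ _ _,
    (sum_secTerm_shift_le M πref β V samp p' T).trans (DCMDP.sum_secTerm_le_SEC hsec fun t => hp _),
    fun n hn => ?_⟩
  have hn2 : 2 ≤ n := (Finset.mem_Icc.1 hn).1
  have hsq := hr.sq_expect_le_secTerm_mul (samp := samp) (p := p') (t := n + 1) (hp _)
    (B := cumSq M πref β samp p n (p n) + 4 * (V + R) ^ 2)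
    (hr.sum_shift_le_cumSq_add (hp n) samp p (one_le_two.trans hn2))
    (hr.sq_le_cumSq_add samp p n _)
  rw [Nat.add_sub_cancel, tilde_sub_one_eq_sampSeq πref samp p hn2] at hsq
  exact hsq

end GeneralStrategy

lemma sum_Ico_le_cumSq_refStrategy (M : DCMDP S A H) (πref : Policy S A) (β : ℝ)
    (p : ℕ → Policy S A) (n : ℕ) (π : Policy S A) :
    ∑ i ∈ Finset.Ico 1 n, expect (M.pairLaw (p i) (PMF.pure πref))
        (fun x => M.discrepancy πref β π x ^ 2) ≤
      cumSq M πref β (refStrategy πref) p n π := by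
  simp only [cumSq, sampSeq_refStrategy, Finset.range_eq_Ico]
  exact Finset.sum_le_sum_of_subset_of_nonneg (Finset.Ico_subset_Ico (Nat.zero_le _) le_rfl)
    fun _ _ _ => expect_nonneg fun _ _ => sq_nonneg _

lemma Realizable.controlled_refStrategy (hr : Realizable M πref Pol β V R πstar)
    (hsec : 0 < M.SEC πref Pol T β V (refStrategy πref)) (hp : ∀ n, 1 ≤ n → p n ∈ Pol) :
    Controlled M πref β V R (refStrategy πref) T (M.SEC πref Pol T β V (refStrategy πref)) p := by
  set p' : ℕ → Policy S A := fun t => p (max t 1)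
  have hp' : ∀ n, 1 ≤ n → p' n = p n := fun n hn => congrArg p (max_eq_left hn)
  have hp'_mem : ∀ n, p' n ∈ Pol := fun n => hp _ (le_max_right n 1)
  have htilde : ∀ n, DCMDP.tilde (refStrategy πref) p' n = PMF.pure πref := fun _ => rfl
  have hcard : T ≤ 3 * (Finset.Icc 1 T).card := by
    rw [Nat.card_Icc]
    lia
  refine ⟨Finset.Icc 1 T, subset_rfl, hcard, M.secTerm πref β V (refStrategy πref) p',
    fun n _ => M.secTerm_nonneg _ _ _ _ _ _, DCMDP.sum_secTerm_le_SEC hsec hp'_mem,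
    fun n hn => ?_⟩
  have hn1 : 1 ≤ n := (Finset.mem_Icc.1 hn).1
  have hsum : ∑ i ∈ Finset.Ico 1 n,
      expect (M.pairLaw (p' i) (DCMDP.tilde (refStrategy πref) p' i))
        (fun x => M.discrepancy πref β (p' n) x ^ 2) ≤
      cumSq M πref β (refStrategy πref) p n (p n) + 4 * (V + R) ^ 2 :=
    calc _ = ∑ i ∈ Finset.Ico 1 n, expect (M.pairLaw (p i) (PMF.pure πref))
            fun x => M.discrepancy πref β (p n) x ^ 2 :=
          Finset.sum_congr rfl fun i hi => by
            rw [htilde, hp' i (Finset.mem_Ico.1 hi).1, hp' n hn1]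
      _ ≤ _ := (sum_Ico_le_cumSq_refStrategy M πref β p n (p n)).trans
        (le_add_of_nonneg_right (by positivity))
  have hsq := hr.sq_expect_le_secTerm_mul (samp := refStrategy πref) (p := p') (t := n)
    (hp'_mem n) hsum (hr.sq_le_cumSq_add (refStrategy πref) p n (p n))
  rw [htilde, hp' n hn1] at hsq
  rwa [sampSeq_refStrategy]

/-! ### The regret of the output policy -/

lemma log_two_le_logTerm {card : ℕ} (hδ₀ : 0 < δ) (hδ₁ : δ ≤ 1) (h : 2 ≤ card * T) :
    Real.log 2 ≤ logTerm card T δ := by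
  have hprod : (2 : ℝ) ≤ card * T := by exact_mod_cast h
  exact Real.log_le_log two_pos (hprod.trans
    (le_mul_of_one_le_right (by positivity) ((one_le_inv₀ hδ₀).2 hδ₁)))

lemma IsOutput.J_seq_le {st : State S A} (h : IsOutput M πref β st πhat) (d : Policy S A) {n : ℕ}
    (hn : n ≤ st.past.length) : M.J πref β (st.seq d n) ≤ M.J πref β πhat :=
  h.2 _ (State.seq_mem_policies hn)

lemma Controlled.sub_le_rate {Jhat : ℝ} (hctrl : Controlled M πref β V R samp T sec p)
    (hr : Realizable M πref Pol β V R πstar) (hc : 0 < c) (hT : 3 ≤ T) (hsec : 0 < sec)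
    (hℓ : Real.log 2 ≤ logTerm Pol.card T δ)
    (hregret : ∀ n ∈ Finset.Icc 1 T, RegretEvent M πref β V R
      (alphaParam c β V R Pol.card T δ sec) (logTerm Pol.card T δ) samp πstar p n)
    (hJhat : ∀ n ≤ T, M.J πref β (p n) ≤ Jhat) :
    M.J πref β πstar - Jhat ≤ rateConst c * rate V R Pol.card T δ sec := by
  rcases le_total (M.J πref β πstar - Jhat) 0 with hneg | hgap
  · exact hneg.trans (mul_nonneg (rateConst_pos hc).le (rate_nonneg hr.pos.le _ _ _ _))
  have hℓ_pos : 0 < logTerm Pol.card T δ := (Real.log_pos one_lt_two).trans_le hℓ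
  have hℓ_ge : 1 / 72 ≤ logTerm Pol.card T δ := by linarith [Real.log_two_gt_d9]
  have hβ := hr.beta_pos
  have hW := hr.pos
  have hT1 : 1 < T := by lia
  have hα : 0 < alphaParam c β V R Pol.card T δ sec := alphaParam_pos hc hβ hW hT1 hsec hℓ_pos
  have hK := infoConst_pos hW
  obtain ⟨I, hI, hcard, t, ht, hsum, hsq⟩ := hctrl
  refine le_rate_of_mul_le hc hβ hr.R_nonneg hW hT1 hsec hℓ_pos
    (mul_le_of_forall_le (by positivity) (by positivity) (by positivity) hgap hT hI hcard ht hsum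
      fun n hn => ?_)
  obtain ⟨hn_pos, hn_le⟩ := Finset.mem_Icc.1 (hI hn)
  exact (sub_le_sub_left (hJhat n hn_le) _).trans ((hregret n (hI hn)).le_of_sq_le hn_pos hα hβ
    hr.R_nonneg hW hℓ_ge (ht n hn) (hsq n hn))

lemma Reached.sub_le_rate_of_le_two {st : State S A} (h : Reached M πref Pol samp πstar T st)
    (hout : IsOutput M πref β st πhat) (hr : Realizable M πref Pol β V R πstar) (hc : 0 < c)
    (hδ₀ : 0 < δ) (hδ₁ : δ ≤ 1) (hT₀ : 0 < T) (hT : T ≤ 2) :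
    M.J πref β πstar - M.J πref β πhat ≤ rateConst c * rate V R Pol.card T δ sec := by
  rcases (Finset.one_le_card.2 ⟨πstar, hr.mem⟩).eq_or_lt with hone | htwo
  · have hfirst : st.seq πstar 1 = πstar :=
      Finset.card_le_one.1 hone.ge _ (h.seq_mem 1 le_rfl) _ hr.mem
    have hJ := hout.J_seq_le πstar (h.past_length.ge.trans' hT₀)
    rw [hfirst] at hJ
    exact (sub_nonpos.2 hJ).trans
      (mul_nonneg (rateConst_pos hc).le (rate_nonneg hr.pos.le _ _ _ _))
  · have hJ := hout.J_seq_le πstar (Nat.zero_le _)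
    rw [h.seq_zero] at hJ
    have href := hr.ret.J_ref_nonneg (β := β) fun τ hτ => (hr.ratio πstar hr.mem τ hτ).1
    have hstar := hr.ret.J_le hr.ratio hr.beta_pos hr.mem
    have hrate := le_rate_of_le_two (sec := sec) hc hr.R_nonneg hr.pos.le hT₀ hT
      (log_two_le_logTerm (card := Pol.card) hδ₀ hδ₁
        (Nat.le_trans htwo (Nat.le_mul_of_pos_right _ hT₀)))
    linarith

theorem Concentrates.ofReal_le_toOuterMeasure_run
    (hconc : Concentrates M πref Pol β V R πstar samp sel draw)
    (hr : Realizable M πref Pol β V R πstar) (hc : 0 < c) (hδ₀ : 0 < δ) (hδ₁ : δ ≤ 1) (hT₀ : 0 < T)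
    (hsec : 0 < sec) (hsel : IsArgmin πref Pol β (alphaParam c β V R Pol.card T δ sec) sel)
    (hctrl : 3 ≤ T → ∀ p : ℕ → Policy S A, p 0 = πref → (∀ n, 1 ≤ n → p n ∈ Pol) →
      Controlled M πref β V R samp T sec p) :
    ENNReal.ofReal (1 - δ) ≤ (run M πref samp sel draw T).toOuterMeasure
      {st | ∀ πhat, IsOutput M πref β st πhat →
        M.J πref β πstar - M.J πref β πhat ≤ rateConst c * rate V R Pol.card T δ sec} := by
  have hreached : ∀ st ∈ (run M πref samp sel draw T).support,
      Reached M πref Pol samp πstar T st :=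
    fun st => reached_of_mem_support_run hr.mem fun st prefs opt => (hsel st prefs opt).1
  rcases Nat.lt_or_ge T 3 with hT | hT
  · exact one_sub_le_toOuterMeasure (t := ∅) hδ₀.le (fun st hst _ πhat hout =>
      (hreached st hst).sub_le_rate_of_le_two hout hr hc hδ₀ hδ₁ hT₀ (Nat.le_of_lt_succ hT))
      (by simp)
  have hcard : 0 < Pol.card := Finset.card_pos.2 ⟨πstar, hr.mem⟩
  have hℓ : Real.log 2 ≤ logTerm Pol.card T δ := log_two_le_logTerm hδ₀ hδ₁
    ((Nat.le_succ 2).trans (hT.trans (Nat.le_mul_of_pos_left T hcard)))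
  have hα : 0 < alphaParam c β V R Pol.card T δ sec := alphaParam_pos hc hr.beta_pos hr.pos
    (by lia) hsec ((Real.log_pos one_lt_two).trans_le hℓ)
  refine one_sub_le_toOuterMeasure hδ₀.le (fun st hst hgood πhat hout => ?_)
    (toOuterMeasure_run_exists_not_regretEvent_le_ofReal hr hsel hconc hα hδ₀ hT₀ hℓ)
  have h := hreached st hst
  simp only [Set.mem_ofPred_eq, not_exists, not_and, not_not] at hgood
  exact (hctrl hT _ h.seq_zero h.seq_mem).sub_le_rate hr hc hT hsec hℓ hgood
    fun n hn => hout.J_seq_le πstar (h.past_length.ge.trans' hn)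

end Main

end XPO

end

open XPO in
theorem mainTheorem2 :
    ∀ c : ℝ, 0 < c → ∃ C : ℝ, 0 < C ∧
      ∀ (S : Type*) (A : Type*) (H : ℕ) (M : DCMDP S A H) (πref : Policy S A)
        (Pol : Finset (Policy S A)) (β V R δ : ℝ) (T : ℕ) (πstar : Policy S A),
        0 < β → 0 < R → 1 ≤ V + R → 0 < δ → δ < 1 → 1 ≤ T →
        M.BoundedReturn R →
        M.IsOptimal πref β πstar → πstar ∈ Pol →
        M.BoundedRatio πref Pol β V →
        -- general sampling strategy
        (∀ samp : Strategy S A, πref ∈ Pol →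
          0 < M.SEC πref Pol T β V samp →
          ∀ sel : Selector S A,
            IsArgmin πref Pol β
              (alphaParam c β V R Pol.card T δ (M.SEC πref Pol T β V samp)) sel →
            ENNReal.ofReal (1 - δ) ≤ (runGeneral M πref samp sel T).toOuterMeasure
              {st | ∀ πhat, IsOutput M πref β st πhat →
                M.J πref β πstar - M.J πref β πhat ≤
                  C * rate V R Pol.card T δ (M.SEC πref Pol T β V samp)}) ∧
        -- sampling from the reference policy
        (0 < M.SEC πref Pol T β V (refStrategy πref) →
          ∀ sel : Selector S A,
            IsArgmin πref Pol β
              (alphaParam c β V R Pol.card T δ (M.SEC πref Pol T β V (refStrategy πref))) sel →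
            ENNReal.ofReal (1 - δ) ≤ (runXPO M πref sel T).toOuterMeasure
              {st | ∀ πhat, IsOutput M πref β st πhat →
                M.J πref β πstar - M.J πref β πhat ≤
                  C * rate V R Pol.card T δ (M.SEC πref Pol T β V (refStrategy πref))}) := by
  intro c hc
  refine ⟨rateConst c, rateConst_pos hc, ?_⟩
  intro S A H M πref Pol β V R δ T πstar hβ _ hW hδ₀ hδ₁ hT hR hopt hstar hV
  have hr : Realizable M πref Pol β V R πstar :=
    ⟨hβ, hW, hR, hV, hstar, hopt.isCalibrated hβ hR hV hstar⟩
  constructor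
  · intro samp href hsec sel hsel
    refine (concentrates_iid hr).ofReal_le_toOuterMeasure_run hr hc hδ₀ hδ₁.le hT hsec hsel
      fun hT3 p hp₀ hp => hr.controlled hsec hT3 fun n => ?_
    rcases Nat.eq_zero_or_pos n with rfl | hn
    · rwa [hp₀]
    · exact hp n hn
  · intro hsec sel hsel
    exact (concentrates_seconds hr).ofReal_le_toOuterMeasure_run hr hc hδ₀ hδ₁.le hT hsec hsel
      fun _ p _ hp => hr.controlled_refStrategy hsec hp
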